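/- \textbf{Theorem.} Let $\varOmega=\varOmega_1\times\cdots\times\varOmega_n$ be a product of measurable spaces, and let $X=(X_1,\ldots,X_n)$ be a random vector with independent components, $X_i$ taking values in $\varOmega_i$. A \emph{decomposition} is a map $\pi:2^{[n]}\times\varOmega\to\mathbb{C}$ such that, for every $V\subseteq[n]$, the function $\pi(V,\cdot)$ is measurable and its value at $x$ depends only on the components $x_j$ with $j\in V$; it is \emph{bounded} if $\|\pi(V,\cdot)\|_\infty=\sup_{x\in\varOmega}|\pi(V,x)|<\infty$ for all $V$. Put \[ f_\pi=\sum_{V\subseteq[n]}\pi(V,\cdot),\qquad \|\pi\|_\gamma=\sum_{V\subseteq[n]}\|\pi(V,\cdot)\|_\infty\,e^{\gamma|V|}. \] For $y\in\varOmega$ and $j\in[n]$ define the operator $R_y^j$ by \[ R_y^j\pi(V,x)=\begin{cases}\pi(V,x)+\pi(V\cup\{j\},x_1,\ldots,x_{j-1},y_j,x_{j+1},\ldots,x_n),& j\notin V,\\ 0,& j\in V,\end{cases} \] let $\partial_y^j=I-R_y^j$ (these operators commute for fixed $y$) and, for $V=\{v_1,\ldots,v_k\}\subseteq[n]$, let $\partial_y^V=\partial_y^{v_1}\cdots\partial_y^{v_k}$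 and \[ \Gamma_{V,\gamma}(\pi)=\sup_{y\in\varOmega}\|\partial_y^V\pi\|_\gamma . \] The cumulants $\kappa_r(W)$, $r\ge 1$, of a bounded complex random variable $W$ are defined by the formal power series identity $\sum_{j\ge0}\mathbb{E}[W^j]\,z^j/j!=\exp\bigl(\sum_{r\ge1}\kappa_r(W)\,z^r/r!\bigr)$. Let $m$ be a positive integer, $\alpha\in[0,\tfrac1{100}]$ and $\gamma\ge\tfrac32\alpha$. Assume that $\pi$ is a bounded decomposition such that \[ \sum_{V\subseteq[n]\,:\,|V|=t,\ j\in V}\Gamma_{V,\gamma}(\pi)\le\alpha\qquad\text{for all } t\in\{1,\ldots,m\},\ j\in[n]. \] Then there is $\delta\in\mathbb{C}$ with $|\delta|\le e^{(100\alpha)^{m+1}}-1$ such that \[ \mathbb{E}\,e^{f_\pi(X)}=(1+\delta)^n\exp\Bigl(\sum_{r=1}^m\frac{\kappa_r(f_\pi(X))}{r!}\Bigr). \] Furthermore, for every $r\in\{2,\ldots,m\}$, \[ |\kappa_r(f_\pi(X))|\le n\,\frac{(r-1)!}{50r}\,(80\alpha)^r . \] -/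

import Mathlib

open MeasureTheory ProbabilityTheory

noncomputable section

/-! ### Decompositions

Throughout, `Ω i` (`i : Fin n`) are the coordinate spaces and a decomposition is a family of
complex functions on the product, indexed by the subsets `V` of the coordinates, such that the
function with index `V` depends only on the coordinates in `V`. -/

section Decomp

variable {n : ℕ} {Ω : Fin n → Type*}

/-- The space `𝒟` of bounded measurable decompositions: `π V` depends only on the coordinates in
`V`, is measurable, and has finite sup norm, for every `V`. -/
structure IsBddDecomposition [∀ i, MeasurableSpace (Ω i)]
    (π : Finset (Fin n) → (∀ i, Ω i) → ℂ) : Prop where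
  dependsOn : ∀ V, DependsOn (π V) (V : Set (Fin n))
  measurable : ∀ V, Measurable (π V)
  bounded : ∀ V, ∃ C : ℝ, ∀ x, ‖π V x‖ ≤ C

/-- The function `f_π = ∑_V π(V, ·)` represented by a decomposition. -/
def decompFun (π : Finset (Fin n) → (∀ i, Ω i) → ℂ) (x : ∀ i, Ω i) : ℂ :=
  ∑ V : Finset (Fin n), π V x

/-- The weighted norm `‖π‖_γ = ∑_V ‖π(V, ·)‖_∞ e^{γ|V|}`. -/
def decompNorm (γ : ℝ) (π : Finset (Fin n) → (∀ i, Ω i) → ℂ) : ℝ :=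
  ∑ V : Finset (Fin n), (⨆ x : ∀ i, Ω i, ‖π V x‖) * Real.exp (γ * (V.card : ℝ))

/-- The operator `R_y^j`, which substitutes `y j` for the `j`-th coordinate. -/
def decompR (y : ∀ i, Ω i) (j : Fin n) (π : Finset (Fin n) → (∀ i, Ω i) → ℂ) :
    Finset (Fin n) → (∀ i, Ω i) → ℂ :=
  fun V x => if j ∈ V then 0 else π V x + π (insert j V) (Function.update x j (y j))

/-- The operator `∂_y^j = I - R_y^j`. -/
def decompPartial (y : ∀ i, Ω i) (j : Fin n) (π : Finset (Fin n) → (∀ i, Ω i) → ℂ) :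
    Finset (Fin n) → (∀ i, Ω i) → ℂ :=
  π - decompR y j π

/-- The operator `∂_y^V`, the composition of the `∂_y^j`, `j ∈ V` (taken here in increasing order;
the operators commute, see `decompPartial_comm`). -/
def decompPartialSet (y : ∀ i, Ω i) (V : Finset (Fin n))
    (π : Finset (Fin n) → (∀ i, Ω i) → ℂ) : Finset (Fin n) → (∀ i, Ω i) → ℂ :=
  (V.sort (· ≤ ·)).foldr (fun j ρ => decompPartial y j ρ) π

/-- The quantity `Γ_{V,γ}(π) = sup_y ‖∂_y^V π‖_γ`. -/
def decompGamma (V : Finset (Fin n)) (γ : ℝ) (π : Finset (Fin n) → (∀ i, Ω i) → ℂ) : ℝ :=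
  ⨆ y : ∀ i, Ω i, decompNorm γ (decompPartialSet y V π)

theorem decompPartial_comm (y : ∀ i, Ω i) (j k : Fin n)
    (π : Finset (Fin n) → (∀ i, Ω i) → ℂ) :
    decompPartial y j (decompPartial y k π) = decompPartial y k (decompPartial y j π) := by
  rcases eq_or_ne j k with rfl | h
  · rfl
  funext V x
  simp only [decompPartial, decompR, Pi.sub_apply, Finset.mem_insert, h, h.symm, false_or]
  by_cases hj : j ∈ V <;> by_cases hk : k ∈ V <;>
    simp [hj, hk, Finset.insert_comm j k V, Function.update_comm h]

theorem norm_decompPartialSet_le {π : Finset (Fin n) → (∀ i, Ω i) → ℂ} {C : ℝ} (hC : 0 ≤ C)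
    (h : ∀ V x, ‖π V x‖ ≤ C) (y : ∀ i, Ω i) (W V : Finset (Fin n)) (x : ∀ i, Ω i) :
    ‖decompPartialSet y W π V x‖ ≤ 3 ^ W.card * C := by
  have key : ∀ (l : List (Fin n)) (V : Finset (Fin n)) (x : ∀ i, Ω i),
      ‖l.foldr (fun j ρ => decompPartial y j ρ) π V x‖ ≤ 3 ^ l.length * C := by
    intro l
    induction l with
    | nil => intro V x; simpa using h V x
    | cons j l ih =>
      intro V x
      have h1 := ih V x
      have h2 := ih (insert j V) (Function.update x j (y j))
      have h0 : 0 ≤ 3 ^ l.length * C := by positivity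
      simp only [decompPartial] at h1 h2
      simp only [List.foldr_cons, List.length_cons, decompPartial, decompR, Pi.sub_apply]
      rw [pow_succ]
      split_ifs
      · rw [sub_zero]; linarith
      · refine (norm_sub_le _ _).trans ?_
        have h4 := norm_add_le (List.foldr (fun j ρ => decompPartial y j ρ) π l V x)
          (List.foldr (fun j ρ => decompPartial y j ρ) π l (insert j V)
            (Function.update x j (y j)))
        simp only [decompPartial] at h4
        linarith
  have := key (W.sort (· ≤ ·)) V x
  rwa [Finset.length_sort] at this

/-- For bounded decompositions the suprema defining `decompNorm` and `decompGamma` are suprema of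
bounded sets of reals. -/
theorem bddAbove_decompNorm_partialSet [∀ i, MeasurableSpace (Ω i)]
    {π : Finset (Fin n) → (∀ i, Ω i) → ℂ} (hπ : IsBddDecomposition π) (W : Finset (Fin n))
    (γ : ℝ) :
    (∀ y V, BddAbove (Set.range fun x => ‖decompPartialSet y W π V x‖)) ∧
      BddAbove (Set.range fun y => decompNorm γ (decompPartialSet y W π)) := by
  choose C hC using hπ.bounded
  have hB : ∀ V x, ‖π V x‖ ≤ ∑ V, |C V| := fun V x =>
    ((hC V x).trans (le_abs_self _)).trans
      (Finset.single_le_sum (f := fun V => |C V|) (fun _ _ => abs_nonneg _) (Finset.mem_univ V))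
  have h0 : 0 ≤ ∑ V, |C V| := Finset.sum_nonneg fun _ _ => abs_nonneg _
  have key := norm_decompPartialSet_le h0 hB
  refine ⟨fun y V => ⟨_, by rintro _ ⟨x, rfl⟩; exact key y W V x⟩,
    ⟨∑ V : Finset (Fin n), (3 ^ W.card * ∑ V, |C V|) * Real.exp (γ * (V.card : ℝ)), ?_⟩⟩
  rintro _ ⟨y, rfl⟩
  refine Finset.sum_le_sum fun V _ => ?_
  have : Nonempty (∀ i, Ω i) := ⟨y⟩
  exact mul_le_mul_of_nonneg_right (ciSup_le fun x => key y W V x) (Real.exp_pos _).le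

end Decomp

/-! ### Cumulants of a bounded complex random variable -/

section Cumulants

variable {S : Type*} [MeasurableSpace S]

/-- The formal power series `∑_j E[W^j] z^j / j!`. -/
def momentSeries (P : Measure S) (W : S → ℂ) : PowerSeries ℂ :=
  PowerSeries.mk fun j => (∫ s, W s ^ j ∂P) / (j.factorial : ℂ)

/-- The `r`-th cumulant `κ_r(W)`: `r!` times the coefficient of `z^r` in the formal logarithm of
`∑_j E[W^j] z^j / j!`. -/
def cumulantOf (P : Measure S) (W : S → ℂ) (r : ℕ) : ℂ :=
  (r.factorial : ℂ) * PowerSeries.coeff r (PowerSeries.logOf (momentSeries P W))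

theorem constantCoeff_momentSeries (P : Measure S) [IsProbabilityMeasure P] (W : S → ℂ) :
    PowerSeries.constantCoeff (momentSeries P W) = 1 := by
  simp [momentSeries, ← PowerSeries.coeff_zero_eq_constantCoeff_apply]

theorem exp_subst_logOf {f : PowerSeries ℂ} (hf : PowerSeries.constantCoeff f = 1) :
    (PowerSeries.exp ℂ).subst (PowerSeries.logOf f) = f := by
  have hL : PowerSeries.HasSubst (PowerSeries.logOf f) :=
    PowerSeries.HasSubst.of_constantCoeff_zero' (PowerSeries.constantCoeff_logOf hf)
  have hs : PowerSeries.HasSubst (f - 1) :=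
    PowerSeries.HasSubst.of_constantCoeff_zero' (by simp [hf])
  have hinv : (1 + PowerSeries.X : PowerSeries ℂ) *
      PowerSeries.derivative ℂ (PowerSeries.log ℂ) = 1 := by
    rw [PowerSeries.deriv_log]
    ext k
    rcases k with _ | k
    · simp [add_mul]
    · simp [add_mul, PowerSeries.coeff_succ_X_mul, PowerSeries.coeff_one, pow_succ]
  have hfD : f * PowerSeries.derivative ℂ (PowerSeries.logOf f) =
      PowerSeries.derivative ℂ f := by
    have h1 := congrArg (PowerSeries.subst (f - 1)) hinv
    rw [PowerSeries.subst_mul hs, PowerSeries.subst_add hs, PowerSeries.subst_X hs,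
      ← PowerSeries.coe_substAlgHom hs, map_one, add_sub_cancel] at h1
    rw [PowerSeries.logOf_eq, PowerSeries.derivative_subst hs, ← mul_assoc,
      ← PowerSeries.coe_substAlgHom hs, h1, one_mul, map_sub]
    simp
  set h := (PowerSeries.exp ℂ).subst (PowerSeries.logOf f) with hh
  have hD : PowerSeries.derivative ℂ h = h * PowerSeries.derivative ℂ (PowerSeries.logOf f) := by
    rw [hh, PowerSeries.derivative_subst hL, PowerSeries.derivative_exp]
  have hh0 : PowerSeries.constantCoeff h = 1 := by
    have h2 : (PowerSeries.exp ℂ).subst (PowerSeries.logOf f) =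
        ((PowerSeries.exp ℂ) - 1).subst (PowerSeries.logOf f) + 1 := by
      rw [← PowerSeries.coe_substAlgHom hL, map_sub, map_one, sub_add_cancel]
    have h3 := PowerSeries.constantCoeff_subst_eq_zero
      (a := PowerSeries.logOf f) (PowerSeries.constantCoeff_logOf hf)
      ((PowerSeries.exp ℂ) - 1) (by simp)
    rw [hh, h2, map_add, map_one]
    exact (congrArg (· + 1) h3).trans (zero_add 1)
  have hu : f * f⁻¹ = 1 := PowerSeries.mul_inv_cancel _ (by simp [hf])
  have hq : h * f⁻¹ = 1 := by
    apply PowerSeries.derivative.ext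
    · rw [Derivation.leibniz, PowerSeries.derivative_inv', hD, ← hfD,
        PowerSeries.derivative_one, smul_eq_mul, smul_eq_mul]
      linear_combination (-h * f⁻¹ * PowerSeries.derivative ℂ (PowerSeries.logOf f)) * hu
    · simp [hh0, hf]
  linear_combination f * hq - h * hu

/-- The defining generating identity of the cumulants:
`∑_j E[W^j] z^j / j! = exp (∑_{r ≥ 1} κ_r(W) z^r / r!)`, as formal power series. -/
theorem momentSeries_eq_exp_cumulantOf (P : Measure S) [IsProbabilityMeasure P] (W : S → ℂ) :
    cumulantOf P W 0 = 0 ∧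
      momentSeries P W = (PowerSeries.exp ℂ).subst
        (PowerSeries.mk fun r => cumulantOf P W r / (r.factorial : ℂ)) := by
  have hc := constantCoeff_momentSeries P W
  refine ⟨by simp [cumulantOf, PowerSeries.constantCoeff_logOf hc], ?_⟩
  have : (PowerSeries.mk fun r => cumulantOf P W r / (r.factorial : ℂ)) =
      PowerSeries.logOf (momentSeries P W) := by
    ext r
    have : (r.factorial : ℂ) ≠ 0 := by exact_mod_cast r.factorial_ne_zero
    simp only [PowerSeries.coeff_mk, cumulantOf]
    field_simp
  rw [this, exp_subst_logOf hc]

end Cumulants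

end

/-!
The logarithm of `Z(w) = E exp (w f_π(X))` has Taylor coefficients `κ_r / r!` at `0`. If
`(log Z)'(w)` differs from its Taylor polynomial of degree `m - 1` by at most `ε` for all
`w ∈ [0, 1]`, then `Z(1) = exp (λ + ∑_{r ≤ m} κ_r / r!)` with `|λ| ≤ ε`, and `1 + δ = exp (λ / n)`.
So `(log Z)'`, which is the sum over `V` of the expectations of `π(V, ·)` in the complex measure
with density `exp (w f_π) / Z(w)`, has to be bounded together with its Taylor coefficients.

Only binomial moments of order below `m` of the sizes `|V|` are available, so the Taylor remainder
cannot be reached through derivatives. Instead, a function of `w` is replaced by the pair of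
its formal Taylor series at `0` and its value at `1` (`Jet`; the value at another `w` is obtained
by rescaling `π`), normed by the Taylor coefficients below an order `N` and the remainder of that
order, with weights `ρ ^ k`. For `1 ≤ ρ` this norm is submultiplicative (`Jet.nrm_mul_le`), and one
computation with it bounds both the low coefficients and the remainder.

The density is controlled by a cluster expansion in the form of an induction on the set `B`
of coordinates on which interactions may live. If the coordinate `j` is frozen, the factors
`exp (w π(V, ·))` with `j ∈ V ⊆ B` are expanded around `1`, and each term is averaged in the
model without `j`; there the marginal density of `k` coordinates is a product of `k` jets `1 + T`
with `T` small, by induction (`Jet.RatioBound.exists_partFun_eq`). Comparing the frozen coordinate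
with the averaged one yields the same smallness of `T` for `B` (`Jet.ratioBound`). A
product of `|V| - 1` factors `1 + T` next to a factor divisible by `w` involves only the binomial
coefficients of `|V| - 1` of order below `m` and `exp (γ (|V| - 1))` (`Jet.nrm_mul_prod_one_add_le`,
`Jet.prodBound_le`), and these moments are what the `Γ_{V,γ}` bound
(`sum_choose_mul_locWeight_le`). The sum of the expectations of all `π(V, ·)` would require one
moment more; dividing by `|V|` when it is distributed over the coordinates removes it
(`Jet.sum_supNorm_mul_prodBound_le`).
-/

noncomputable section

/-! ### Jets: Taylor series with a remainder -/

/-- The data kept of a function of `w`: its Taylor series at `0`, as a formal power series, and its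
value at `1`. Sums and products are componentwise; no convergence relates the two components. -/
abbrev Jet : Type := PowerSeries ℂ × ℂ

namespace Jet

/-- The coordinates of a jet at truncation order `N`: the Taylor coefficients below `N`, then the
Taylor remainder at `1`. -/
def coord (N : ℕ) (F : Jet) (k : ℕ) : ℂ :=
  if k < N then PowerSeries.coeff k F.1 else F.2 - ∑ i ∈ Finset.range N, PowerSeries.coeff i F.1

/-- The `ℓ¹` norm of the coordinates with weights `ρ ^ k`. For `1 ≤ ρ` it is submultiplicative,
because a product of coordinates of orders `i` and `j` contributes to the order `min (i + j) N`. -/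
def nrm (N : ℕ) (ρ : ℝ) (F : Jet) : ℝ :=
  ∑ k ∈ Finset.range (N + 1), ‖coord N F k‖ * ρ ^ k

variable {N : ℕ} {ρ : ℝ}

theorem coord_of_lt {k : ℕ} (h : k < N) (F : Jet) : coord N F k = PowerSeries.coeff k F.1 :=
  if_pos h

theorem coord_self (F : Jet) :
    coord N F N = F.2 - ∑ i ∈ Finset.range N, PowerSeries.coeff i F.1 :=
  if_neg (lt_irrefl _)

theorem sum_coord_range (F : Jet) :
    ∑ k ∈ Finset.range N, coord N F k = ∑ k ∈ Finset.range N, PowerSeries.coeff k F.1 :=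
  Finset.sum_congr rfl fun _ hk => coord_of_lt (Finset.mem_range.1 hk) F

theorem sum_coord (F : Jet) : ∑ k ∈ Finset.range (N + 1), coord N F k = F.2 := by
  rw [Finset.sum_range_succ, sum_coord_range, coord_self]; ring

theorem coord_add (F G : Jet) (k : ℕ) : coord N (F + G) k = coord N F k + coord N G k := by
  unfold coord
  split_ifs
  · simp
  · simp [Finset.sum_add_distrib]; ring

theorem coord_neg (F : Jet) (k : ℕ) : coord N (-F) k = -coord N F k := by
  unfold coord
  split_ifs
  · simp
  · simp; ring

theorem coord_mul {k : ℕ} (hk : k ≤ N) (F G : Jet) :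
    coord N (F * G) k =
      ∑ p ∈ (Finset.range (N + 1) ×ˢ Finset.range (N + 1)) with min (p.1 + p.2) N = k,
        coord N F p.1 * coord N G p.2 := by
  have low : ∀ k < N, PowerSeries.coeff k (F * G).1 =
      ∑ p ∈ (Finset.range (N + 1) ×ˢ Finset.range (N + 1)) with min (p.1 + p.2) N = k,
        coord N F p.1 * coord N G p.2 := by
    intro k hk
    rw [Prod.fst_mul, PowerSeries.coeff_mul]
    have : Finset.HasAntidiagonal.antidiagonal k =
        {p ∈ Finset.range (N + 1) ×ˢ Finset.range (N + 1) | min (p.1 + p.2) N = k} := by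
      ext p
      simp only [Finset.HasAntidiagonal.mem_antidiagonal, Finset.mem_filter, Finset.mem_product,
        Finset.mem_range]
      omega
    rw [← this]
    refine Finset.sum_congr rfl fun p hp => ?_
    have := Finset.HasAntidiagonal.mem_antidiagonal.1 hp
    rw [coord_of_lt (by omega), coord_of_lt (by omega)]
  rcases hk.lt_or_eq with hk | rfl
  · rw [coord_of_lt hk, low k hk]
  · rw [coord_self, Finset.sum_congr rfl fun i hi => low i (Finset.mem_range.1 hi),
      sub_eq_iff_eq_add, add_comm, ← Finset.sum_range_succ (fun i => ∑ p ∈ (Finset.range (k + 1) ×ˢ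
        Finset.range (k + 1)) with min (p.1 + p.2) k = i, coord k F p.1 * coord k G p.2),
      Finset.sum_fiberwise_of_maps_to, Prod.snd_mul, ← sum_coord (N := k) F,
      ← sum_coord (N := k) G, Finset.sum_mul_sum, Finset.sum_product]
    intro p hp
    rw [Finset.mem_range]; omega

theorem nrm_nonneg (hρ : 0 ≤ ρ) (F : Jet) : 0 ≤ nrm N ρ F :=
  Finset.sum_nonneg fun _ _ => by positivity

theorem nrm_add_le (hρ : 0 ≤ ρ) (F G : Jet) : nrm N ρ (F + G) ≤ nrm N ρ F + nrm N ρ G := by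
  unfold nrm
  rw [← Finset.sum_add_distrib]
  refine Finset.sum_le_sum fun k _ => ?_
  rw [coord_add, ← add_mul]
  exact mul_le_mul_of_nonneg_right (norm_add_le _ _) (by positivity)

theorem nrm_neg (F : Jet) : nrm N ρ (-F) = nrm N ρ F := by
  simp [nrm, coord_neg]

theorem nrm_sub_le (hρ : 0 ≤ ρ) (F G : Jet) : nrm N ρ (F - G) ≤ nrm N ρ F + nrm N ρ G := by
  rw [sub_eq_add_neg, ← nrm_neg G]
  exact nrm_add_le hρ _ _

theorem nrm_zero : nrm N ρ 0 = 0 := by simp [nrm, coord]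

theorem nrm_sum_le {ι : Type*} (hρ : 0 ≤ ρ) (s : Finset ι) (F : ι → Jet) :
    nrm N ρ (∑ i ∈ s, F i) ≤ ∑ i ∈ s, nrm N ρ (F i) :=
  Finset.le_sum_of_subadditive _ nrm_zero.le (nrm_add_le hρ) _ _

theorem nrm_mul_le (hρ : 1 ≤ ρ) (F G : Jet) : nrm N ρ (F * G) ≤ nrm N ρ F * nrm N ρ G := by
  have h0 : 0 ≤ ρ := by linarith
  calc nrm N ρ (F * G)
      ≤ ∑ k ∈ Finset.range (N + 1),
          ∑ p ∈ (Finset.range (N + 1) ×ˢ Finset.range (N + 1)) with min (p.1 + p.2) N = k,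
            (‖coord N F p.1‖ * ρ ^ p.1) * (‖coord N G p.2‖ * ρ ^ p.2) := by
        refine Finset.sum_le_sum fun k hk => ?_
        rw [coord_mul (Nat.lt_succ_iff.1 (Finset.mem_range.1 hk))]
        refine (mul_le_mul_of_nonneg_right (norm_sum_le _ _) (by positivity)).trans ?_
        rw [Finset.sum_mul]
        refine Finset.sum_le_sum fun p hp => ?_
        have hp := (Finset.mem_filter.1 hp).2
        have : ρ ^ k ≤ ρ ^ p.1 * ρ ^ p.2 := by
          rw [← pow_add]; exact pow_le_pow_right₀ hρ (by omega)
        rw [norm_mul]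
        calc _ ≤ ‖coord N F p.1‖ * ‖coord N G p.2‖ * (ρ ^ p.1 * ρ ^ p.2) := by gcongr
          _ = _ := by ring
    _ = nrm N ρ F * nrm N ρ G := by
        rw [Finset.sum_fiberwise_of_maps_to, nrm, nrm, Finset.sum_mul_sum, Finset.sum_product]
        intro p hp
        rw [Finset.mem_range]; omega

/-- The value of a jet that vanishes to order `d` gains a factor `ρ ^ d` over its norm. -/
theorem norm_snd_mul_pow_le (hρ : 1 ≤ ρ) {F : Jet} {d : ℕ} (hd : d ≤ N)
    (h : PowerSeries.X ^ d ∣ F.1) : ‖F.2‖ * ρ ^ d ≤ nrm N ρ F := by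
  have h0 : 0 ≤ ρ := by linarith
  rw [← sum_coord (N := N) F]
  refine (mul_le_mul_of_nonneg_right (norm_sum_le _ _) (by positivity)).trans ?_
  rw [Finset.sum_mul]
  refine Finset.sum_le_sum fun k _ => ?_
  rcases lt_or_ge k d with hk | hk
  · rw [coord_of_lt (hk.trans_le hd), PowerSeries.X_pow_dvd_iff.1 h k hk]; simp
  · gcongr

theorem norm_snd_le (hρ : 1 ≤ ρ) (F : Jet) : ‖F.2‖ ≤ nrm N ρ F := by
  simpa using norm_snd_mul_pow_le (N := N) (d := 0) hρ (Nat.zero_le _) (F := F) (by simp)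

theorem nrm_of_X_pow_dvd {F : Jet} (h : PowerSeries.X ^ N ∣ F.1) :
    nrm N ρ F = ‖F.2‖ * ρ ^ N := by
  have h1 := PowerSeries.X_pow_dvd_iff.1 h
  rw [nrm, Finset.sum_range_succ, Finset.sum_eq_zero, coord_self, Finset.sum_eq_zero, zero_add,
    sub_zero]
  · exact fun k hk => h1 k (Finset.mem_range.1 hk)
  · intro k hk
    rw [coord_of_lt (Finset.mem_range.1 hk), h1 k (Finset.mem_range.1 hk)]; simp

theorem norm_coeff_mul_pow_le (hρ : 0 ≤ ρ) (F : Jet) {k : ℕ} (hk : k < N) :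
    ‖PowerSeries.coeff k F.1‖ * ρ ^ k ≤ nrm N ρ F := by
  rw [← coord_of_lt hk]
  exact Finset.single_le_sum (f := fun k => ‖coord N F k‖ * ρ ^ k)
    (fun _ _ => by positivity) (Finset.mem_range.2 (by omega))

theorem norm_remainder_mul_pow_le (hρ : 0 ≤ ρ) (F : Jet) :
    ‖F.2 - ∑ i ∈ Finset.range N, PowerSeries.coeff i F.1‖ * ρ ^ N ≤ nrm N ρ F := by
  rw [← coord_self]
  exact Finset.single_le_sum (f := fun k => ‖coord N F k‖ * ρ ^ k)
    (fun _ _ => by positivity) (Finset.mem_range.2 (by omega))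

/-- The jet of a constant function of `w`. -/
def const (c : ℂ) : Jet := (PowerSeries.C c, c)

theorem const_one : const 1 = 1 := by simp [const, Prod.ext_iff]

theorem nrm_const (hN : 0 < N) (c : ℂ) : nrm N ρ (const c) = ‖c‖ := by
  obtain ⟨N, rfl⟩ := Nat.exists_eq_succ_of_ne_zero hN.ne'
  rw [nrm, Finset.sum_range_succ, coord_self, Finset.sum_range_succ', Finset.sum_eq_zero]
  · simp [coord, const, Finset.sum_range_succ' (fun i => PowerSeries.coeff i (PowerSeries.C c))]
  · intro k hk
    rw [coord_of_lt (by simpa using hk)]; simp [const]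

theorem nrm_const_le (c : ℂ) : nrm N ρ (const c) ≤ ‖c‖ := by
  rcases Nat.eq_zero_or_pos N with rfl | hN
  · simp [nrm, coord, const]
  · exact (nrm_const hN c).le

theorem nrm_one_le : nrm N ρ 1 ≤ 1 := by
  simpa [const_one] using nrm_const_le (N := N) (ρ := ρ) 1

theorem nrm_prod_le {ι : Type*} (hρ : 1 ≤ ρ) (s : Finset ι) (F : ι → Jet) :
    nrm N ρ (∏ i ∈ s, F i) ≤ ∏ i ∈ s, nrm N ρ (F i) := by
  classical
  induction s using Finset.induction_on with
  | empty => simpa using nrm_one_le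
  | insert a s ha ih =>
    rw [Finset.prod_insert ha, Finset.prod_insert ha]
    exact (nrm_mul_le hρ _ _).trans
      (mul_le_mul_of_nonneg_left ih (nrm_nonneg (by linarith) _))

/-- The inverse of `1 + d` by the geometric series bound. -/
theorem nrm_le_of_one_add_mul_eq_one (hρ : 1 ≤ ρ) {d e : Jet} {η : ℝ} (hη : η < 1)
    (hd : nrm N ρ d ≤ η) (h : (1 + d) * e = 1) : nrm N ρ e ≤ 1 / (1 - η) := by
  have h0 : 0 ≤ ρ := by linarith
  have h1 : e = 1 - d * e := by linear_combination h
  have h2 : nrm N ρ e ≤ 1 + η * nrm N ρ e := by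
    calc nrm N ρ e = nrm N ρ (1 - d * e) := by rw [← h1]
      _ ≤ nrm N ρ 1 + nrm N ρ (d * e) := nrm_sub_le h0 _ _
      _ ≤ 1 + nrm N ρ d * nrm N ρ e := add_le_add nrm_one_le (nrm_mul_le hρ _ _)
      _ ≤ _ := by gcongr; exact nrm_nonneg h0 _
  rw [le_div_iff₀ (by linarith)]
  linarith

/-- The jet of `w ↦ exp (w * c)`. -/
def expo (c : ℂ) : Jet := (PowerSeries.rescale c (PowerSeries.exp ℂ), Complex.exp c)

theorem expo_add (a b : ℂ) : expo (a + b) = expo a * expo b := by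
  simp [expo, Complex.exp_add, PowerSeries.exp_mul_exp_eq_exp_add]

theorem expo_zero : expo 0 = 1 := by
  simp [expo, Prod.ext_iff]

theorem expo_sum {ι : Type*} (s : Finset ι) (c : ι → ℂ) :
    expo (∑ i ∈ s, c i) = ∏ i ∈ s, expo (c i) := by
  classical
  induction s using Finset.induction_on with
  | empty => simp [expo_zero]
  | insert a s ha ih => rw [Finset.sum_insert ha, Finset.prod_insert ha, expo_add, ih]

theorem coeff_expo (c : ℂ) (k : ℕ) :
    PowerSeries.coeff k (expo c).1 = c ^ k / (k.factorial : ℂ) := by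
  simp [expo, PowerSeries.coeff_rescale, PowerSeries.coeff_exp, div_eq_mul_inv]

theorem X_dvd_expo_sub_one (c : ℂ) : PowerSeries.X ∣ (expo c - 1 : Jet).1 := by
  rw [PowerSeries.X_dvd_iff, ← PowerSeries.coeff_zero_eq_constantCoeff_apply]
  rw [Prod.fst_sub, map_sub, coeff_expo]; simp

theorem nrm_expo_sub_one_le (hN : 0 < N) (hρ : 1 ≤ ρ) (c : ℂ) :
    nrm N ρ (expo c - 1) ≤ Real.exp (ρ * ‖c‖) - 1 := by
  have h0 : 0 ≤ ρ := by linarith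
  obtain ⟨N, rfl⟩ := Nat.exists_eq_succ_of_ne_zero hN.ne'
  have hsc : HasSum (fun k : ℕ => c ^ k / (k.factorial : ℂ)) (Complex.exp c) := by
    rw [Complex.exp_eq_exp_ℂ]; exact NormedSpace.expSeries_div_hasSum_exp c
  have hsr : HasSum (fun k : ℕ => (ρ * ‖c‖) ^ k / (k.factorial : ℝ)) (Real.exp (ρ * ‖c‖)) := by
    rw [Real.exp_eq_exp_ℝ]; exact NormedSpace.expSeries_div_hasSum_exp (ρ * ‖c‖)
  have htail : ‖Complex.exp c - ∑ i ∈ Finset.range (N + 1), c ^ i / (i.factorial : ℂ)‖ *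
      ρ ^ (N + 1) ≤ Real.exp (ρ * ‖c‖) -
        ∑ i ∈ Finset.range (N + 1), (ρ * ‖c‖) ^ i / (i.factorial : ℝ) := by
    have e1 := (hasSum_nat_add_iff' (N + 1)).2 hsc
    have e2 := (hasSum_nat_add_iff' (N + 1)).2 hsr
    rw [← e1.tsum_eq, ← e2.tsum_eq]
    have e3 : Summable fun i : ℕ =>
        ‖c ^ (i + (N + 1)) / ((i + (N + 1)).factorial : ℂ)‖ := e1.summable.norm
    refine (mul_le_mul_of_nonneg_right (norm_tsum_le_tsum_norm e3) (by positivity)).trans ?_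
    rw [← tsum_mul_right]
    refine Summable.tsum_le_tsum (fun i => ?_) (e3.mul_right _) e2.summable
    rw [norm_div, norm_pow, mul_pow, Complex.norm_natCast, div_mul_eq_mul_div,
      mul_comm (ρ ^ _)]
    gcongr ‖c‖ ^ _ * ?_ / _
    exact pow_le_pow_right₀ hρ (by omega)
  have hc : ∀ k, PowerSeries.coeff k (expo c - 1 : Jet).1 =
      c ^ k / (k.factorial : ℂ) - if k = 0 then 1 else 0 := by
    intro k
    rw [Prod.fst_sub, map_sub, coeff_expo, Prod.fst_one, PowerSeries.coeff_one]
  have key : nrm (N + 1) ρ (expo c - 1) =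
      ∑ k ∈ Finset.range N, (ρ * ‖c‖) ^ (k + 1) / ((k + 1).factorial : ℝ) +
      ‖Complex.exp c - ∑ i ∈ Finset.range (N + 1), c ^ i / (i.factorial : ℂ)‖ *
      ρ ^ (N + 1) := by
    rw [nrm, Finset.sum_range_succ, coord_self]
    congr 1
    · rw [Finset.sum_range_succ', coord_of_lt (by omega), hc]
      simp only [pow_zero, Nat.factorial_zero, Nat.cast_one, div_one, if_true, sub_self, norm_zero,
        zero_mul, add_zero]
      refine Finset.sum_congr rfl fun k hk => ?_
      rw [coord_of_lt (by simpa using hk), hc, if_neg (by omega), sub_zero, norm_div, norm_pow,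
        Complex.norm_natCast, mul_pow]
      ring
    · congr 2
      simp only [hc, Finset.sum_sub_distrib]
      simp [expo]
  rw [Finset.sum_range_succ' (fun i => (ρ * ‖c‖) ^ i / (i.factorial : ℝ))] at htail
  simp only [pow_zero, Nat.factorial_zero, Nat.cast_one, div_one] at htail
  rw [key]
  linarith

/-! ### Products of perturbations of one -/

/-- A bound for the norm at order `N` of a product of `k` jets without constant term and of norm at
most `θ`. From `k = N` on, such a product consists of its remainder only, and there every factor
has modulus at most `θ / ρ`. -/
def prodWeight (N : ℕ) (ρ θ : ℝ) (k : ℕ) : ℝ := if k < N then θ ^ k else ρ ^ N * (θ / ρ) ^ k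

/-- A bound for the norm of a product of `l` jets of the form `1 + T`, where `T` has norm at most
`θ` and no constant term: the terms with `k` factors `T` have weight `prodWeight N ρ θ k`. -/
def prodBound (N : ℕ) (ρ θ : ℝ) (l : ℕ) : ℝ :=
  ∑ k ∈ Finset.range (l + 1), (l.choose k : ℝ) * prodWeight N ρ θ k

variable {θ : ℝ}

theorem prodWeight_nonneg (hρ : 0 ≤ ρ) (hθ : 0 ≤ θ) (k : ℕ) : 0 ≤ prodWeight N ρ θ k := by
  unfold prodWeight; split_ifs <;> positivity

theorem prodBound_mono (hρ : 0 ≤ ρ) (hθ : 0 ≤ θ) {a b : ℕ} (h : a ≤ b) :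
    prodBound N ρ θ a ≤ prodBound N ρ θ b := by
  unfold prodBound
  calc _ ≤ ∑ k ∈ Finset.range (a + 1), (b.choose k : ℝ) * prodWeight N ρ θ k := by
        refine Finset.sum_le_sum fun k _ =>
          mul_le_mul_of_nonneg_right ?_ (prodWeight_nonneg hρ hθ k)
        exact_mod_cast Nat.choose_le_choose k h
    _ ≤ _ := Finset.sum_le_sum_of_subset_of_nonneg
        (Finset.range_subset_range.2 (by omega))
        fun k _ _ => mul_nonneg (Nat.cast_nonneg _) (prodWeight_nonneg hρ hθ k)

theorem prodBound_nonneg (hρ : 0 ≤ ρ) (hθ : 0 ≤ θ) (a : ℕ) : 0 ≤ prodBound N ρ θ a :=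
  Finset.sum_nonneg fun k _ => mul_nonneg (Nat.cast_nonneg _) (prodWeight_nonneg hρ hθ k)

theorem nrm_mul_prod_le {ι : Type*} (hρ : 1 ≤ ρ) {d : ℕ} (hd : d ≤ N) (hN : 0 < N)
    {p : Jet} (hp : PowerSeries.X ^ d ∣ p.1) (s : Finset ι) (T : ι → Jet)
    (hT : ∀ i ∈ s, nrm N ρ (T i) ≤ θ) (hT0 : ∀ i ∈ s, PowerSeries.X ∣ (T i).1) :
    nrm N ρ (p * ∏ i ∈ s, T i) ≤ nrm N ρ p * prodWeight (N - d) ρ θ s.card := by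
  have h0 : 0 < ρ := by linarith
  unfold prodWeight
  split_ifs with h
  · refine (nrm_mul_le hρ _ _).trans (mul_le_mul_of_nonneg_left ?_ (nrm_nonneg h0.le _))
    refine (nrm_prod_le hρ _ _).trans ?_
    rw [← Finset.prod_const]
    exact Finset.prod_le_prod (fun i _ => nrm_nonneg h0.le _) hT
  · have hdvd : PowerSeries.X ^ N ∣ (p * ∏ i ∈ s, T i).1 := by
      refine (pow_dvd_pow _ (show N ≤ d + s.card by omega)).trans ?_
      rw [pow_add, Prod.fst_mul, Prod.fst_prod]
      refine mul_dvd_mul hp ?_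
      rw [← Finset.prod_const]
      exact Finset.prod_dvd_prod_of_dvd _ _ hT0
    have h1 : ‖(∏ i ∈ s, T i).2‖ ≤ (θ / ρ) ^ s.card := by
      rw [Prod.snd_prod, norm_prod]
      rw [← Finset.prod_const]
      refine Finset.prod_le_prod (fun i _ => norm_nonneg _) fun i hi => ?_
      rw [le_div_iff₀ h0]
      have := norm_snd_mul_pow_le (d := 1) hρ hN (F := T i) (by simpa using hT0 i hi)
      rw [pow_one] at this
      exact this.trans (hT i hi)
    have h2 := norm_snd_mul_pow_le hρ hd hp
    rw [nrm_of_X_pow_dvd hdvd, Prod.snd_mul, norm_mul]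
    calc ‖p.2‖ * ‖(∏ i ∈ s, T i).2‖ * ρ ^ N
        = (‖p.2‖ * ρ ^ d) * (ρ ^ (N - d) * ‖(∏ i ∈ s, T i).2‖) := by
          rw [show ρ ^ N = ρ ^ d * ρ ^ (N - d) by rw [← pow_add]; congr 1; omega]; ring
      _ ≤ _ := by
          have := nrm_nonneg (N := N) h0.le p
          gcongr

/-- A factor `p` divisible by `X ^ d` lowers the order to which the product has to be expanded. -/
theorem nrm_mul_prod_one_add_le {ι : Type*} (hρ : 1 ≤ ρ) {d : ℕ}
    (hd : d ≤ N) (hN : 0 < N) {p : Jet} (hp : PowerSeries.X ^ d ∣ p.1) (s : Finset ι)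
    (T : ι → Jet) (hT : ∀ i ∈ s, nrm N ρ (T i) ≤ θ)
    (hT0 : ∀ i ∈ s, PowerSeries.X ∣ (T i).1) :
    nrm N ρ (p * ∏ i ∈ s, (1 + T i)) ≤ nrm N ρ p * prodBound (N - d) ρ θ s.card := by
  classical
  have h0 : 0 ≤ ρ := by linarith
  rw [Finset.prod_one_add, Finset.mul_sum]
  refine (nrm_sum_le h0 _ _).trans ?_
  have : ∀ u ∈ s.powerset, nrm N ρ (p * ∏ i ∈ u, T i) ≤
      nrm N ρ p * prodWeight (N - d) ρ θ u.card := fun u hu =>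
    nrm_mul_prod_le hρ hd hN hp u T (fun i hi => hT i (Finset.mem_powerset.1 hu hi))
      fun i hi => hT0 i (Finset.mem_powerset.1 hu hi)
  refine (Finset.sum_le_sum this).trans ?_
  rw [← Finset.mul_sum, Finset.sum_powerset_apply_card (fun k => prodWeight (N - d) ρ θ k),
    prodBound]
  simp [nsmul_eq_mul]

/-- The terms of a binomial expansion from order `N` on, in terms of the `N`-th one. -/
theorem sum_choose_mul_pow_le {τ : ℝ} (hτ : 0 ≤ τ) (l N : ℕ) :
    ∑ k ∈ Finset.range (l + 1) with N ≤ k, (l.choose k : ℝ) * τ ^ k ≤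
      (l.choose N : ℝ) * τ ^ N * (1 + τ) ^ l := by
  rcases lt_or_ge l N with h | h
  · rw [Finset.sum_eq_zero]
    · positivity
    · intro k hk
      have := Finset.mem_filter.1 hk
      rw [Finset.mem_range] at this
      omega
  obtain ⟨q, rfl⟩ := Nat.exists_eq_add_of_le h
  calc ∑ k ∈ Finset.range (N + q + 1) with N ≤ k, ((N + q).choose k : ℝ) * τ ^ k
      = ∑ i ∈ Finset.range (q + 1), ((N + q).choose (N + i) : ℝ) * τ ^ (N + i) := by
        symm
        refine Finset.sum_bij (fun i _ => N + i) ?_ ?_ ?_ ?_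
        · intro i hi
          rw [Finset.mem_range] at hi
          rw [Finset.mem_filter, Finset.mem_range]; omega
        · intro i _ k _ h; omega
        · intro k hk
          rw [Finset.mem_filter, Finset.mem_range] at hk
          exact ⟨k - N, by rw [Finset.mem_range]; omega, by omega⟩
        · intro i _; rfl
    _ ≤ ∑ i ∈ Finset.range (q + 1),
          ((N + q).choose N : ℝ) * τ ^ N * ((q.choose i : ℝ) * τ ^ i) := by
        refine Finset.sum_le_sum fun i hi => ?_
        rw [Finset.mem_range] at hi
        have h1 : (N + q).choose (N + i) ≤ (N + q).choose N * q.choose i := by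
          have := Nat.choose_mul (n := N + q) (k := N + i) (s := N) (by omega)
          rw [show N + q - N = q by omega, show N + i - N = i by omega] at this
          rw [← this]
          exact Nat.le_mul_of_pos_right _ (Nat.choose_pos (by omega))
        have h2 : ((N + q).choose (N + i) : ℝ) ≤ (N + q).choose N * q.choose i := by
          exact_mod_cast h1
        calc ((N + q).choose (N + i) : ℝ) * τ ^ (N + i)
            ≤ ((N + q).choose N * q.choose i) * τ ^ (N + i) := by gcongr
          _ = _ := by rw [pow_add]; ring
    _ = ((N + q).choose N : ℝ) * τ ^ N * (1 + τ) ^ q := by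
        rw [← Finset.mul_sum, add_comm (1 : ℝ) τ, add_pow]
        congr 1
        refine Finset.sum_congr rfl fun i _ => ?_
        rw [one_pow]; ring
    _ ≤ _ := by
        gcongr
        · linarith
        · omega

end Jet

/-! ### Integrals of jet-valued functions -/

/-- Bounded measurable complex functions. -/
def BddMeas {α : Type*} [MeasurableSpace α] (f : α → ℂ) : Prop :=
  Measurable f ∧ ∃ C : ℝ, ∀ x, ‖f x‖ ≤ C

namespace BddMeas

variable {α β : Type*} [MeasurableSpace α] [MeasurableSpace β] {f g : α → ℂ}

theorem const (c : ℂ) : BddMeas fun _ : α => c := ⟨measurable_const, ‖c‖, fun _ => le_rfl⟩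

theorem add (hf : BddMeas f) (hg : BddMeas g) : BddMeas fun x => f x + g x := by
  obtain ⟨hf, C, hC⟩ := hf
  obtain ⟨hg, D, hD⟩ := hg
  exact ⟨hf.add hg, C + D, fun x => (norm_add_le _ _).trans (add_le_add (hC x) (hD x))⟩

theorem mul (hf : BddMeas f) (hg : BddMeas g) : BddMeas fun x => f x * g x := by
  obtain ⟨hf, C, hC⟩ := hf
  obtain ⟨hg, D, hD⟩ := hg
  refine ⟨hf.mul hg, C * D, fun x => ?_⟩
  rw [norm_mul]
  exact mul_le_mul (hC x) (hD x) (norm_nonneg _) ((norm_nonneg _).trans (hC x))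

theorem sum {ι : Type*} (s : Finset ι) {f : ι → α → ℂ} (hf : ∀ i ∈ s, BddMeas (f i)) :
    BddMeas fun x => ∑ i ∈ s, f i x := by
  classical
  induction s using Finset.induction_on with
  | empty => simpa using const 0
  | insert a s ha ih =>
    simp only [Finset.sum_insert ha]
    exact (hf a (Finset.mem_insert_self a s)).add
      (ih fun i hi => hf i (Finset.mem_insert_of_mem hi))

theorem pow (hf : BddMeas f) (k : ℕ) : BddMeas fun x => f x ^ k := by
  induction k with
  | zero => simpa using const 1
  | succ k ih => simpa only [pow_succ] using ih.mul hf

theorem cexp (hf : BddMeas f) : BddMeas fun x => Complex.exp (f x) := by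
  obtain ⟨hf, C, hC⟩ := hf
  refine ⟨hf.cexp, Real.exp C, fun x => ?_⟩
  rw [Complex.norm_exp]
  exact Real.exp_le_exp.2 ((Complex.re_le_norm _).trans (hC x))

theorem comp (hf : BddMeas f) {φ : β → α} (hφ : Measurable φ) : BddMeas fun x => f (φ x) := by
  obtain ⟨hf, C, hC⟩ := hf
  exact ⟨hf.comp hφ, C, fun x => hC _⟩

theorem integrable (hf : BddMeas f) (μ : Measure α) [IsFiniteMeasure μ] : Integrable f μ := by
  obtain ⟨hf, C, hC⟩ := hf
  exact Integrable.of_bound hf.aestronglyMeasurable C (Filter.Eventually.of_forall hC)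

theorem integral_prod {f : α × β → ℂ} (hf : BddMeas f) (ν : Measure β) [IsProbabilityMeasure ν] :
    BddMeas fun x => ∫ y, f (x, y) ∂ν := by
  obtain ⟨hf, C, hC⟩ := hf
  refine ⟨(hf.stronglyMeasurable.integral_prod_right').measurable, C, fun x => ?_⟩
  simpa using norm_integral_le_of_norm_le_const (μ := ν)
    (Filter.Eventually.of_forall fun y => hC (x, y))

end BddMeas

namespace Jet

section Integral

variable {α β : Type*} [MeasurableSpace α] [MeasurableSpace β]

/-- Jet-valued functions all of whose Taylor coefficients and values are bounded and
measurable. -/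
def BddMeasJet (F : α → Jet) : Prop :=
  (∀ k, BddMeas fun x => PowerSeries.coeff k (F x).1) ∧ BddMeas fun x => (F x).2

/-- The coefficientwise integral of a jet-valued function. -/
def integral (μ : Measure α) (F : α → Jet) : Jet :=
  (PowerSeries.mk fun k => ∫ x, PowerSeries.coeff k (F x).1 ∂μ, ∫ x, (F x).2 ∂μ)

theorem BddMeasJet.const (c : Jet) : BddMeasJet fun _ : α => c :=
  ⟨fun _ => BddMeas.const _, BddMeas.const _⟩

theorem BddMeasJet.mul {F G : α → Jet} (hF : BddMeasJet F) (hG : BddMeasJet G) :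
    BddMeasJet fun x => F x * G x := by
  refine ⟨fun k => ?_, hF.2.mul hG.2⟩
  simp only [Prod.fst_mul, PowerSeries.coeff_mul]
  exact BddMeas.sum _ fun p _ => (hF.1 _).mul (hG.1 _)

theorem BddMeasJet.sub {F G : α → Jet} (hF : BddMeasJet F) (hG : BddMeasJet G) :
    BddMeasJet fun x => F x - G x := by
  have h : ∀ {f g : α → ℂ}, BddMeas f → BddMeas g → BddMeas fun x => f x - g x :=
    fun hf hg => by simpa [sub_eq_add_neg] using hf.add ((BddMeas.const (-1)).mul hg)
  exact ⟨fun k => by simpa using h (hF.1 k) (hG.1 k), h hF.2 hG.2⟩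

theorem BddMeasJet.prod {ι : Type*} (s : Finset ι) {F : ι → α → Jet}
    (hF : ∀ i ∈ s, BddMeasJet (F i)) : BddMeasJet fun x => ∏ i ∈ s, F i x := by
  classical
  induction s using Finset.induction_on with
  | empty => simpa using const 1
  | insert a s ha ih =>
    simp only [Finset.prod_insert ha]
    exact (hF a (Finset.mem_insert_self a s)).mul
      (ih fun i hi => hF i (Finset.mem_insert_of_mem hi))

theorem BddMeasJet.expo {f : α → ℂ} (hf : BddMeas f) : BddMeasJet fun x => expo (f x) := by
  refine ⟨fun k => ?_, hf.cexp⟩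
  simp only [coeff_expo, div_eq_mul_inv]
  exact (hf.pow k).mul (BddMeas.const _)

theorem BddMeasJet.constJet {f : α → ℂ} (hf : BddMeas f) :
    BddMeasJet fun x => Jet.const (f x) := by
  refine ⟨fun k => ?_, hf⟩
  simp only [Jet.const, PowerSeries.coeff_C]
  split_ifs
  · exact hf
  · exact BddMeas.const 0

theorem BddMeasJet.comp {F : α → Jet} (hF : BddMeasJet F) {φ : β → α} (hφ : Measurable φ) :
    BddMeasJet fun x => F (φ x) :=
  ⟨fun k => (hF.1 k).comp hφ, hF.2.comp hφ⟩

variable {μ : Measure α} [IsProbabilityMeasure μ]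

theorem integral_const (c : Jet) : integral μ (fun _ => c) = c := by
  refine Prod.ext ?_ ?_
  · ext k; simp [integral]
  · simp [integral]

theorem integral_mul_const {F : α → Jet} (hF : BddMeasJet F) (c : Jet) :
    integral μ (fun x => F x * c) = integral μ F * c := by
  refine Prod.ext ?_ ?_
  · ext k
    simp only [integral, Prod.fst_mul, PowerSeries.coeff_mul, PowerSeries.coeff_mk]
    rw [integral_finsetSum _ fun p _ => ((hF.1 p.1).integrable μ).mul_const _]
    simp only [MeasureTheory.integral_mul_const]
  · simp only [integral, Prod.snd_mul, MeasureTheory.integral_mul_const]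

theorem integral_sum {ι : Type*} (s : Finset ι) {F : ι → α → Jet}
    (hF : ∀ i ∈ s, BddMeasJet (F i)) :
    integral μ (fun x => ∑ i ∈ s, F i x) = ∑ i ∈ s, integral μ (F i) := by
  refine Prod.ext ?_ ?_
  · ext k
    simp only [integral, Prod.fst_sum, map_sum, PowerSeries.coeff_mk]
    rw [integral_finsetSum _ fun i hi => ((hF i hi).1 k).integrable μ]
  · simp only [integral, Prod.snd_sum]
    rw [integral_finsetSum _ fun i hi => (hF i hi).2.integrable μ]

theorem coord_integral {N : ℕ} {F : α → Jet} (hF : BddMeasJet F) (k : ℕ) :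
    coord N (integral μ F) k = ∫ x, coord N (F x) k ∂μ := by
  unfold coord
  split_ifs
  · simp [integral]
  · rw [integral_sub (hF.2.integrable μ)
      (integrable_finsetSum _ fun i _ => (hF.1 i).integrable μ),
      integral_finsetSum _ fun i _ => (hF.1 i).integrable μ]
    simp [integral]

theorem integrable_coord {N : ℕ} {F : α → Jet} (hF : BddMeasJet F) (k : ℕ) :
    Integrable (fun x => coord N (F x) k) μ := by
  unfold coord
  split_ifs
  · exact (hF.1 k).integrable μ
  · exact (hF.2.integrable μ).sub
      (integrable_finsetSum _ fun i _ => (hF.1 i).integrable μ)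

theorem nrm_integral_le {N : ℕ} {ρ b : ℝ} (hρ : 0 ≤ ρ) {F : α → Jet} (hF : BddMeasJet F)
    (h : ∀ x, nrm N ρ (F x) ≤ b) : nrm N ρ (integral μ F) ≤ b := by
  have hi : ∀ k, Integrable (fun x => ‖coord N (F x) k‖ * ρ ^ k) μ := fun k =>
    (integrable_coord hF k).norm.mul_const _
  calc nrm N ρ (integral μ F)
      ≤ ∑ k ∈ Finset.range (N + 1), ∫ x, ‖coord N (F x) k‖ * ρ ^ k ∂μ := by
        refine Finset.sum_le_sum fun k _ => ?_
        rw [coord_integral hF, MeasureTheory.integral_mul_const]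
        exact mul_le_mul_of_nonneg_right (norm_integral_le_integral_norm _) (by positivity)
    _ = ∫ x, nrm N ρ (F x) ∂μ := (integral_finsetSum _ fun k _ => hi k).symm
    _ ≤ ∫ _, b ∂μ := integral_mono (integrable_finsetSum _ fun k _ => hi k)
        (integrable_const _) h
    _ = b := by simp

end Integral

/-! ### Partial averages over a product space -/

section Average

variable {n : ℕ} {Ω : Fin n → Type*} [∀ i, MeasurableSpace (Ω i)]

theorem measurable_piecewise_uncurry (A : Finset (Fin n)) :
    Measurable fun p : (∀ i, Ω i) × (∀ i, Ω i) => A.piecewise p.2 p.1 := by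
  refine measurable_pi_lambda _ fun i => ?_
  by_cases h : i ∈ A
  · simp only [h, Finset.piecewise_eq_of_mem]; fun_prop
  · simp only [h, not_false_eq_true, Finset.piecewise_eq_of_notMem]; fun_prop

theorem measurable_piecewise_left (A : Finset (Fin n)) (x : ∀ i, Ω i) :
    Measurable fun y : ∀ i, Ω i => A.piecewise y x :=
  (measurable_piecewise_uncurry A).comp (measurable_const.prodMk measurable_id)

variable (μ : ∀ i, Measure (Ω i))

/-- The average of `F` over the coordinates in `A`, the others being frozen at `x`. -/
def avg (A : Finset (Fin n)) (F : (∀ i, Ω i) → Jet) (x : ∀ i, Ω i) : Jet :=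
  integral (Measure.pi μ) fun y => F (A.piecewise y x)

variable {μ}

theorem avg_congr {A : Finset (Fin n)} {F G : (∀ i, Ω i) → Jet} {x : ∀ i, Ω i}
    (h : ∀ y, (∀ i ∉ A, y i = x i) → F y = G y) : avg μ A F x = avg μ A G x := by
  unfold avg
  congr 1
  funext y
  exact h _ fun i hi => Finset.piecewise_eq_of_notMem _ _ _ hi

theorem avg_congr_point {A : Finset (Fin n)} (F : (∀ i, Ω i) → Jet) {x x' : ∀ i, Ω i}
    (h : ∀ i ∉ A, x i = x' i) : avg μ A F x = avg μ A F x' := by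
  unfold avg
  congr 1
  funext y
  congr 1
  funext i
  by_cases hi : i ∈ A
  · simp [hi]
  · simp [hi, h i hi]

variable (μ) [∀ i, IsProbabilityMeasure (μ i)]

/-- Resampling the coordinates in `A` from an independent copy preserves a product measure. -/
theorem measurePreserving_piecewise (A : Finset (Fin n)) :
    MeasurePreserving (fun p : (∀ i, Ω i) × (∀ i, Ω i) => A.piecewise p.2 p.1)
      ((Measure.pi μ).prod (Measure.pi μ)) (Measure.pi μ) := by
  refine ⟨measurable_piecewise_uncurry A, (Measure.pi_eq fun s hs => ?_).symm⟩
  rw [Measure.map_apply (measurable_piecewise_uncurry A) (MeasurableSet.univ_pi hs)]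
  have : (fun p : (∀ i, Ω i) × (∀ i, Ω i) => A.piecewise p.2 p.1) ⁻¹' Set.univ.pi s =
      (Set.univ.pi fun i => if i ∈ A then Set.univ else s i) ×ˢ
        (Set.univ.pi fun i => if i ∈ A then s i else Set.univ) := by
    ext p
    simp only [Set.mem_preimage, Set.mem_prod, Set.mem_univ_pi, ← forall_and]
    refine forall_congr' fun i => ?_
    by_cases h : i ∈ A <;> simp [h]
  rw [this, Measure.prod_prod, Measure.pi_pi, Measure.pi_pi, ← Finset.prod_mul_distrib]
  refine Finset.prod_congr rfl fun i _ => ?_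
  by_cases h : i ∈ A <;> simp [h]

variable {μ}

theorem avg_empty (F : (∀ i, Ω i) → Jet) (x : ∀ i, Ω i) : avg μ ∅ F x = F x := by
  simp [avg, integral_const]

theorem bddMeasJet_avg {F : (∀ i, Ω i) → Jet} (hF : BddMeasJet F) (A : Finset (Fin n)) :
    BddMeasJet (avg μ A F) := by
  have h := hF.comp (measurable_piecewise_uncurry A)
  refine ⟨fun k => ?_, (h.2).integral_prod (Measure.pi μ)⟩
  simpa [avg, integral] using (h.1 k).integral_prod (Measure.pi μ)

theorem avg_mul_const {F : (∀ i, Ω i) → Jet} (hF : BddMeasJet F) (A : Finset (Fin n))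
    (c : Jet) (x : ∀ i, Ω i) : avg μ A (fun y => F y * c) x = avg μ A F x * c :=
  integral_mul_const (hF.comp (measurable_piecewise_left A x)) c

theorem avg_sum {ι : Type*} (s : Finset ι) {F : ι → (∀ i, Ω i) → Jet}
    (hF : ∀ i ∈ s, BddMeasJet (F i)) (A : Finset (Fin n)) (x : ∀ i, Ω i) :
    avg μ A (fun y => ∑ i ∈ s, F i y) x = ∑ i ∈ s, avg μ A (F i) x :=
  integral_sum s fun i hi => (hF i hi).comp (measurable_piecewise_left A x)

theorem nrm_avg_le {N : ℕ} {ρ b : ℝ} (hρ : 0 ≤ ρ) {F : (∀ i, Ω i) → Jet} (hF : BddMeasJet F)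
    {A : Finset (Fin n)} {x : ∀ i, Ω i}
    (h : ∀ y, (∀ i ∉ A, y i = x i) → nrm N ρ (F y) ≤ b) : nrm N ρ (avg μ A F x) ≤ b :=
  nrm_integral_le hρ (hF.comp (measurable_piecewise_left A x)) fun _ =>
    h _ fun _ hi => Finset.piecewise_eq_of_notMem _ _ _ hi

theorem integral_integral_piecewise {f : (∀ i, Ω i) → ℂ} (hf : BddMeas f)
    (A C : Finset (Fin n)) (x : ∀ i, Ω i) :
    ∫ y, ∫ z, f (C.piecewise z (A.piecewise y x)) ∂Measure.pi μ ∂Measure.pi μ =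
      ∫ y, f ((A ∪ C).piecewise y x) ∂Measure.pi μ := by
  have h1 : ∀ y z : ∀ i, Ω i, C.piecewise z (A.piecewise y x) =
      (A ∪ C).piecewise (C.piecewise z y) x := by
    intro y z
    funext i
    by_cases hC : i ∈ C <;> by_cases hA : i ∈ A <;> simp [hC, hA]
  simp only [h1]
  have hg : BddMeas fun y => f ((A ∪ C).piecewise y x) :=
    hf.comp (measurable_piecewise_left (A ∪ C) x)
  have key : ∫ y, f ((A ∪ C).piecewise y x) ∂Measure.pi μ =
      ∫ p : (∀ i, Ω i) × (∀ i, Ω i), f ((A ∪ C).piecewise (C.piecewise p.2 p.1) x)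
        ∂(Measure.pi μ).prod (Measure.pi μ) := by
    have h2 := integral_map (μ := (Measure.pi μ).prod (Measure.pi μ))
      (measurable_piecewise_uncurry C).aemeasurable
      (f := fun y => f ((A ∪ C).piecewise y x)) hg.1.aestronglyMeasurable
    rwa [(measurePreserving_piecewise μ C).map_eq] at h2
  rw [key]
  exact (integral_prod _ ((hg.comp (measurable_piecewise_uncurry C)).integrable
    ((Measure.pi μ).prod (Measure.pi μ)))).symm

/-- Averages can be taken in stages. -/
theorem avg_avg {F : (∀ i, Ω i) → Jet} (hF : BddMeasJet F) (A C : Finset (Fin n))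
    (x : ∀ i, Ω i) : avg μ A (avg μ C F) x = avg μ (A ∪ C) F x := by
  refine Prod.ext ?_ ?_
  · ext k
    simpa [avg, integral] using integral_integral_piecewise (hF.1 k) A C x
  · simpa [avg, integral] using integral_integral_piecewise hF.2 A C x

end Average

/-! ### Partition functions with frozen coordinates -/

theorem exists_mul_eq_one {F : Jet} (h0 : PowerSeries.coeff 0 F.1 = 1) (h : F.2 ≠ 0) :
    ∃ e : Jet, F * e = 1 := by
  refine ⟨(F.1⁻¹, F.2⁻¹), Prod.ext ?_ (mul_inv_cancel₀ h)⟩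
  refine PowerSeries.mul_inv_cancel _ ?_
  rw [← PowerSeries.coeff_zero_eq_constantCoeff_apply, h0]
  exact one_ne_zero

section Model

variable {n : ℕ} {Ω : Fin n → Type*}

/-- The jet of the Boltzmann weight `w ↦ exp (w * ∑_{V ⊆ B} π(V, y))`. -/
def weight (π : Finset (Fin n) → (∀ i, Ω i) → ℂ) (B : Finset (Fin n)) (y : ∀ i, Ω i) : Jet :=
  expo (∑ V ∈ B.powerset, π V y)

/-- The supremum of `|π(V, ·)|` over the points whose `j`-th coordinate is that of `x`. -/
def condSup (π : Finset (Fin n) → (∀ i, Ω i) → ℂ) (j : Fin n) (V : Finset (Fin n))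
    (x : ∀ i, Ω i) : ℝ :=
  ⨆ z : ∀ i, Ω i, ‖π V (Function.update z j (x j))‖

theorem condSup_nonneg (π : Finset (Fin n) → (∀ i, Ω i) → ℂ) (j : Fin n)
    (V : Finset (Fin n)) (x : ∀ i, Ω i) : 0 ≤ condSup π j V x :=
  Real.iSup_nonneg fun _ => norm_nonneg _

variable [∀ i, MeasurableSpace (Ω i)]

/-- The partition function with interactions inside `B`, coordinates in `A` averaged and the other
ones frozen at `x`. -/
def partFun (μ : ∀ i, Measure (Ω i)) (π : Finset (Fin n) → (∀ i, Ω i) → ℂ)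
    (A B : Finset (Fin n)) (x : ∀ i, Ω i) : Jet :=
  avg μ A (weight π B) x

variable {μ : ∀ i, Measure (Ω i)} {π : Finset (Fin n) → (∀ i, Ω i) → ℂ}

variable (μ π) in
/-- Removing a coordinate of `A` from the average multiplies the partition function by `1 + T`
for a small jet `T` without constant term. -/
def RatioBound (m : ℕ) (ρ θ : ℝ) (B : Finset (Fin n)) : Prop :=
  ∀ A ⊆ B, ∀ x, (partFun μ π A B x).2 ≠ 0 ∧ ∀ j ∈ A, ∃ T : Jet,
    nrm m ρ T ≤ θ ∧ PowerSeries.X ∣ T.1 ∧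
      partFun μ π (A.erase j) B x = (1 + T) * partFun μ π A B x

variable {m : ℕ} {ρ θ : ℝ}

theorem RatioBound.sdiff {B : Finset (Fin n)} (h : RatioBound μ π m ρ θ B)
    {A : Finset (Fin n)} (hA : A ⊆ B) (x : ∀ i, Ω i) (U : Finset (Fin n)) (hU : U ⊆ A) :
    ∃ T : Fin n → Jet, (∀ i ∈ U, nrm m ρ (T i) ≤ θ) ∧ (∀ i ∈ U, PowerSeries.X ∣ (T i).1) ∧
      partFun μ π (A \ U) B x = (∏ i ∈ U, (1 + T i)) * partFun μ π A B x := by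
  induction U using Finset.induction_on with
  | empty => exact ⟨fun _ => 0, by simp, by simp, by simp⟩
  | insert a U ha ih =>
    obtain ⟨T, h1, h2, h3⟩ := ih ((Finset.subset_insert a U).trans hU)
    obtain ⟨t, k1, k2, k3⟩ := (h (A \ U) (Finset.sdiff_subset.trans hA) x).2 a
      (Finset.mem_sdiff.2 ⟨hU (Finset.mem_insert_self a U), ha⟩)
    have hne : ∀ i ∈ U, Function.update T a t i = T i := fun i hi =>
      Function.update_of_ne (ne_of_mem_of_not_mem hi ha) _ _
    refine ⟨Function.update T a t, ?_, ?_, ?_⟩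
    · intro i hi
      rcases Finset.mem_insert.1 hi with rfl | hi
      · simpa using k1
      · rw [hne i hi]; exact h1 i hi
    · intro i hi
      rcases Finset.mem_insert.1 hi with rfl | hi
      · simpa using k2
      · rw [hne i hi]; exact h2 i hi
    · rw [Finset.sdiff_insert, k3, h3, Finset.prod_insert ha, Function.update_self,
        Finset.prod_congr rfl fun i hi => congrArg (1 + ·) (hne i hi), mul_assoc]

variable [∀ i, IsProbabilityMeasure (μ i)]

theorem _root_.IsBddDecomposition.bddMeas (hπ : IsBddDecomposition π) (V : Finset (Fin n)) :
    BddMeas (π V) :=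
  ⟨hπ.measurable V, hπ.bounded V⟩

theorem norm_le_condSup (hπ : IsBddDecomposition π) (V : Finset (Fin n)) {j : Fin n}
    {x y : ∀ i, Ω i} (h : y j = x j) : ‖π V y‖ ≤ condSup π j V x := by
  obtain ⟨C, hC⟩ := hπ.bounded V
  have := le_ciSup (f := fun z : ∀ i, Ω i => ‖π V (Function.update z j (x j))‖)
    ⟨C, by rintro _ ⟨z, rfl⟩; exact hC _⟩ y
  simpa [condSup, ← h] using this

theorem bddMeasJet_weight (hπ : IsBddDecomposition π) (B : Finset (Fin n)) :
    BddMeasJet (weight π B) :=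
  BddMeasJet.expo (BddMeas.sum _ fun V _ => hπ.bddMeas V)

theorem coeff_zero_partFun (A B : Finset (Fin n)) (x : ∀ i, Ω i) :
    PowerSeries.coeff 0 (partFun μ π A B x).1 = 1 := by
  simp [partFun, avg, integral, weight, coeff_expo]

/-- The expectation of `h` in the tilted measure is the average of `h` against products of factors
`1 + T`, one for each averaged coordinate on which `h` depends. -/
theorem RatioBound.nrm_avg_mul_le {B : Finset (Fin n)} (hB : RatioBound μ π m ρ θ B) (hρ : 0 ≤ ρ)
    (hπ : IsBddDecomposition π) {A : Finset (Fin n)} (hA : A ⊆ B) (x : ∀ i, Ω i) {e : Jet}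
    (he : partFun μ π A B x * e = 1) {h : (∀ i, Ω i) → Jet} (hh : BddMeasJet h)
    (U : Finset (Fin n)) (hdep : ∀ y z, (∀ i ∉ A \ U, y i = z i) → h y = h z) {b : ℝ}
    (hb : ∀ y, (∀ i ∉ A, y i = x i) → ∀ T : Fin n → Jet,
      (∀ i ∈ A ∩ U, nrm m ρ (T i) ≤ θ) → (∀ i ∈ A ∩ U, PowerSeries.X ∣ (T i).1) →
        nrm m ρ (h y * ∏ i ∈ A ∩ U, (1 + T i)) ≤ b) :
    nrm m ρ (avg μ A (fun y => h y * weight π B y) x * e) ≤ b := by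
  have hw := bddMeasJet_weight hπ B
  have inner : ∀ y, avg μ (A \ U) (fun y => h y * weight π B y) y =
      partFun μ π (A \ U) B y * h y := by
    intro y
    rw [partFun, ← avg_mul_const hw]
    exact avg_congr fun z hz => by rw [hdep z y hz, mul_comm]
  have hU : A ∩ U ∪ A \ U = A := by
    rw [Finset.union_comm]; exact Finset.sdiff_union_inter A U
  have hsd : A \ (A ∩ U) = A \ U := Finset.sdiff_inter_self_left A U
  have hF : BddMeasJet (avg μ (A \ U) fun y => h y * weight π B y) :=
    bddMeasJet_avg (hh.mul hw) _
  have h2 := avg_avg (μ := μ) (hh.mul hw) (A ∩ U) (A \ U) x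
  rw [hU] at h2
  rw [← h2, ← avg_mul_const hF]
  refine nrm_avg_le hρ (hF.mul (BddMeasJet.const e)) fun y hy => ?_
  have hy' : ∀ i ∉ A, y i = x i := fun i hi => hy i fun h => hi (Finset.mem_inter.1 h).1
  obtain ⟨T, t1, t2, t3⟩ := hB.sdiff hA y (A ∩ U) Finset.inter_subset_left
  have hZ : partFun μ π A B y = partFun μ π A B x := avg_congr_point _ hy'
  rw [hsd, hZ] at t3
  convert hb y hy' T t1 t2 using 2
  rw [inner, t3]
  linear_combination (h y * ∏ i ∈ A ∩ U, (1 + T i)) * he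

/-- Each factor `1 + T i` is charged to one of the sets `V ∈ S` that contain `i`. -/
theorem nrm_prod_mul_prod_le (hρ : 1 ≤ ρ) (hθ : 0 ≤ θ) (hm : 0 < m) (j : Fin n)
    (S : Finset (Finset (Fin n))) (hS : ∀ V ∈ S, j ∈ V) (p : Finset (Fin n) → Jet)
    (hp : ∀ V ∈ S, PowerSeries.X ∣ (p V).1) (T : Fin n → Jet) (U : Finset (Fin n))
    (hU : U ⊆ S.biUnion fun V => V.erase j) (hT : ∀ i ∈ U, nrm m ρ (T i) ≤ θ)
    (hT0 : ∀ i ∈ U, PowerSeries.X ∣ (T i).1) :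
    nrm m ρ ((∏ V ∈ S, p V) * ∏ i ∈ U, (1 + T i)) ≤
      ∏ V ∈ S, nrm m ρ (p V) * prodBound (m - 1) ρ θ (V.card - 1) := by
  have h0 : 0 ≤ ρ := by linarith
  induction S using Finset.induction_on generalizing U with
  | empty =>
    have : U = ∅ := by simpa using hU
    subst this
    simpa using nrm_one_le
  | insert V S hV ih =>
    rw [Finset.prod_insert hV, Finset.prod_insert hV]
    have hsplit : ∏ i ∈ U, (1 + T i) =
        (∏ i ∈ U ∩ V.erase j, (1 + T i)) * ∏ i ∈ U \ V.erase j, (1 + T i) := by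
      rw [← Finset.prod_inter_mul_prod_sdiff U (V.erase j)]
    have h1 := nrm_mul_prod_one_add_le hρ hm hm (p := p V) (d := 1)
      (by simpa using hp V (Finset.mem_insert_self V S)) (U ∩ V.erase j) T
      (fun i hi => hT i (Finset.mem_inter.1 hi).1) (fun i hi => hT0 i (Finset.mem_inter.1 hi).1)
    have hcard : (U ∩ V.erase j).card ≤ V.card - 1 := by
      rw [← Finset.card_erase_of_mem (hS V (Finset.mem_insert_self V S))]
      exact Finset.card_le_card Finset.inter_subset_right
    have h2 := ih (fun W hW => hS W (Finset.mem_insert_of_mem hW))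
      (fun W hW => hp W (Finset.mem_insert_of_mem hW)) (U \ V.erase j)
      (by
        rw [Finset.biUnion_insert] at hU
        exact sdiff_le_iff.2 hU)
      (fun i hi => hT i (Finset.mem_sdiff.1 hi).1) (fun i hi => hT0 i (Finset.mem_sdiff.1 hi).1)
    calc _ = nrm m ρ ((p V * ∏ i ∈ U ∩ V.erase j, (1 + T i)) *
          ((∏ V ∈ S, p V) * ∏ i ∈ U \ V.erase j, (1 + T i))) := by
          rw [hsplit]; congr 1; ring
      _ ≤ _ := nrm_mul_le hρ _ _
      _ ≤ _ := by
          refine mul_le_mul (h1.trans ?_) h2 (nrm_nonneg h0 _)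
            (mul_nonneg (nrm_nonneg h0 _) (prodBound_nonneg h0 hθ _))
          exact mul_le_mul_of_nonneg_left (prodBound_mono h0 hθ hcard) (nrm_nonneg h0 _)

/-- Switching on the interactions that contain a frozen coordinate `j`: the product of the factors
`exp (w π(V, ·))`, `j ∈ V`, is expanded around `1` and averaged in the tilted measure without
them. -/
theorem RatioBound.exists_partFun_eq {G : ℝ} (hπ : IsBddDecomposition π) (hm : 0 < m)
    (hρ : 1 ≤ ρ) (hθ : 0 ≤ θ) {j : Fin n}
    (hG : ∀ x : ∀ i, Ω i, ∑ V : Finset (Fin n) with j ∈ V,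
      (Real.exp (ρ * condSup π j V x) - 1) * prodBound (m - 1) ρ θ (V.card - 1) ≤ G)
    {B : Finset (Fin n)} (hj : j ∈ B) (hB : RatioBound μ π m ρ θ (B.erase j))
    {A : Finset (Fin n)} (hA : A ⊆ B.erase j) (x : ∀ i, Ω i) :
    ∃ d : Jet, nrm m ρ d ≤ Real.exp G - 1 ∧
      partFun μ π A B x = (1 + d) * partFun μ π A (B.erase j) x := by
  have h0 : 0 ≤ ρ := by linarith
  have hjA : j ∉ A := fun h => Finset.notMem_erase j B (hA h)
  obtain ⟨e, he⟩ := exists_mul_eq_one (coeff_zero_partFun A (B.erase j) x) (hB A hA x).1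
  set 𝒱 : Finset (Finset (Fin n)) := {V ∈ B.powerset | j ∈ V} with h𝒱
  -- the Mayer expansion of the factors with `j ∈ V`
  have hsplit : ∀ y, weight π B y =
      ∑ S ∈ 𝒱.powerset, (∏ V ∈ S, (expo (π V y) - 1)) * weight π (B.erase j) y := by
    intro y
    rw [← Finset.sum_mul, ← Finset.prod_one_add, weight, weight, expo_sum, expo_sum,
      ← Finset.prod_filter_mul_prod_filter_not B.powerset (fun V => j ∈ V)]
    congr 1
    · exact Finset.prod_congr rfl fun V _ => by ring
    · refine Finset.prod_congr ?_ fun _ _ => rfl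
      ext V
      rw [Finset.mem_filter, Finset.mem_powerset, Finset.mem_powerset, Finset.subset_erase]
  have hbm : ∀ S, BddMeasJet fun y => ∏ V ∈ S, (expo (π V y) - 1) := fun S =>
    BddMeasJet.prod S fun V _ => (BddMeasJet.expo (hπ.bddMeas V)).sub (BddMeasJet.const 1)
  have hw := bddMeasJet_weight hπ (B.erase j)
  set g : Finset (Fin n) → ℝ := fun V =>
    (Real.exp (ρ * condSup π j V x) - 1) * prodBound (m - 1) ρ θ (V.card - 1) with hg
  have hg0 : ∀ V, 0 ≤ g V := fun V => mul_nonneg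
    (sub_nonneg.2 (Real.one_le_exp (mul_nonneg h0 (condSup_nonneg _ _ _ _))))
    (prodBound_nonneg h0 hθ _)
  have term : ∀ S ∈ 𝒱.powerset, nrm m ρ (avg μ A (fun y =>
      (∏ V ∈ S, (expo (π V y) - 1)) * weight π (B.erase j) y) x * e) ≤ ∏ V ∈ S, g V := by
    intro S hS
    have hSj : ∀ V ∈ S, j ∈ V := fun V hV =>
      (Finset.mem_filter.1 (Finset.mem_powerset.1 hS hV)).2
    refine hB.nrm_avg_mul_le h0 hπ hA x he (hbm S) (S.biUnion fun V => V.erase j) ?_ ?_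
    · intro y z hyz
      refine Finset.prod_congr rfl fun V hV => ?_
      rw [hπ.dependsOn V fun i hi => hyz i fun hi' => ?_]
      rw [Finset.mem_sdiff, Finset.mem_biUnion] at hi'
      refine hi'.2 ⟨V, hV, Finset.mem_erase.2 ⟨?_, hi⟩⟩
      rintro rfl
      exact hjA hi'.1
    · intro y hy T hT hT0
      refine (nrm_prod_mul_prod_le hρ hθ hm j S hSj _ (fun V _ => X_dvd_expo_sub_one _) T _
        Finset.inter_subset_right hT hT0).trans ?_
      refine Finset.prod_le_prod (fun V _ => mul_nonneg (nrm_nonneg h0 _)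
        (prodBound_nonneg h0 hθ _)) fun V _ => ?_
      refine mul_le_mul_of_nonneg_right ((nrm_expo_sub_one_le hm hρ _).trans ?_)
        (prodBound_nonneg h0 hθ _)
      have := norm_le_condSup hπ V (hy j hjA)
      gcongr
  set D : Finset (Finset (Fin n)) → Jet := fun S =>
    avg μ A (fun y => (∏ V ∈ S, (expo (π V y) - 1)) * weight π (B.erase j) y) x * e with hD
  have hZ : partFun μ π A B x * e = ∑ S ∈ 𝒱.powerset, D S := by
    rw [partFun, avg_congr fun y _ => hsplit y,
      avg_sum _ (fun S _ => (hbm S).mul hw), Finset.sum_mul]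
  have hD0 : D ∅ = 1 := by simpa [hD, partFun] using he
  have hemp : ∅ ∈ 𝒱.powerset := Finset.empty_mem_powerset _
  refine ⟨∑ S ∈ 𝒱.powerset.erase ∅, D S, ?_, ?_⟩
  · calc nrm m ρ (∑ S ∈ 𝒱.powerset.erase ∅, D S)
        ≤ ∑ S ∈ 𝒱.powerset.erase ∅, ∏ V ∈ S, g V :=
          (nrm_sum_le h0 _ _).trans
            (Finset.sum_le_sum fun S hS => term S (Finset.mem_of_mem_erase hS))
      _ = ∏ V ∈ 𝒱, (1 + g V) - 1 := by
          rw [Finset.prod_one_add, ← Finset.add_sum_erase _ _ hemp]; simp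
      _ ≤ Real.exp (∑ V ∈ 𝒱, g V) - 1 := by
          rw [Real.exp_sum]
          gcongr with V _
          · exact fun V _ => by linarith [hg0 V]
          · rw [add_comm]; exact Real.add_one_le_exp _
      _ ≤ Real.exp G - 1 := by
          gcongr
          refine (Finset.sum_le_sum_of_subset_of_nonneg ?_ fun V _ _ => hg0 V).trans (hG x)
          intro V hV
          exact Finset.mem_filter.2 ⟨Finset.mem_univ V, (Finset.mem_filter.1 hV).2⟩
  · rw [← hD0, Finset.add_sum_erase _ _ hemp, ← hZ, mul_assoc, mul_comm e, he, mul_one]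

/-- Induction on the set of allowed interactions. With `η = exp G - 1`, the partition functions with
the `j`-th coordinate frozen and averaged are `1 + d` and `1 + d'` times the one without `j`, where
`d` and `d'` have norm at most `η`; their quotient differs from `1` by at most `2 η / (1 - η)`. -/
theorem ratioBound {G : ℝ} (hπ : IsBddDecomposition π) (hm : 0 < m) (hρ : 1 ≤ ρ) (hθ : 0 ≤ θ)
    (hG : ∀ j, ∀ x : ∀ i, Ω i, ∑ V : Finset (Fin n) with j ∈ V,
      (Real.exp (ρ * condSup π j V x) - 1) * prodBound (m - 1) ρ θ (V.card - 1) ≤ G)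
    (hη : Real.exp G - 1 < 1)
    (hθη : 2 * (Real.exp G - 1) / (1 - (Real.exp G - 1)) ≤ θ) (B : Finset (Fin n)) :
    RatioBound μ π m ρ θ B := by
  have h0 : 0 ≤ ρ := by linarith
  induction B using Finset.strongInduction with
  | H B ih =>
    intro A hA x
    set η := Real.exp G - 1 with hηdef
    have step : ∀ j ∈ A, (partFun μ π A B x).2 ≠ 0 ∧ ∃ T : Jet,
        nrm m ρ T ≤ θ ∧ PowerSeries.X ∣ T.1 ∧
          partFun μ π (A.erase j) B x = (1 + T) * partFun μ π A B x := by
      intro j hj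
      have hBj := ih _ (Finset.erase_ssubset (hA hj))
      have hA' : A.erase j ⊆ B.erase j := Finset.erase_subset_erase j hA
      obtain ⟨hv, -⟩ := hBj _ hA' x
      obtain ⟨e, he⟩ := exists_mul_eq_one (coeff_zero_partFun (A.erase j) (B.erase j) x) hv
      have hex := fun y => hBj.exists_partFun_eq hπ hm hρ hθ (hG j) (hA hj) hA' y
      have hbase : ∀ y, (∀ i ∉ ({j} : Finset (Fin n)), y i = x i) →
          partFun μ π (A.erase j) (B.erase j) y = partFun μ π (A.erase j) (B.erase j) x := by
        intro y hy
        have hdep : ∀ z z' : ∀ i, Ω i, (∀ i, i ≠ j → z i = z' i) →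
            weight π (B.erase j) z = weight π (B.erase j) z' := by
          intro z z' hz
          unfold weight
          congr 1
          refine Finset.sum_congr rfl fun V hV => hπ.dependsOn V fun i hi => hz i ?_
          rintro rfl
          exact Finset.notMem_erase i B (Finset.mem_powerset.1 hV hi)
        unfold partFun avg
        congr 1
        funext z
        refine hdep _ _ fun i hi => ?_
        by_cases hiA : i ∈ A.erase j
        · rw [Finset.piecewise_eq_of_mem _ _ _ hiA, Finset.piecewise_eq_of_mem _ _ _ hiA]
        · rw [Finset.piecewise_eq_of_notMem _ _ _ hiA, Finset.piecewise_eq_of_notMem _ _ _ hiA]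
          exact hy i (by simpa using hi)
      have hw := bddMeasJet_weight hπ B
      have hF : BddMeasJet fun y => partFun μ π (A.erase j) B y :=
        bddMeasJet_avg hw _
      -- the relative increment after averaging over the coordinate `j` as well
      have hstage : partFun μ π A B x = avg μ {j} (fun y => partFun μ π (A.erase j) B y) x := by
        have := avg_avg (μ := μ) hw {j} (A.erase j) x
        rw [← Finset.insert_eq, Finset.insert_erase hj] at this
        exact this.symm
      have hF1 : BddMeasJet fun y => partFun μ π (A.erase j) B y * e - 1 :=
        (hF.mul (BddMeasJet.const e)).sub (BddMeasJet.const 1)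
      have hdbar : nrm m ρ (partFun μ π A B x * e - 1) ≤ η := by
        have : partFun μ π A B x * e - 1 =
            avg μ {j} (fun y => partFun μ π (A.erase j) B y * e - 1) x := by
          have h1 := avg_sum (μ := μ) (Finset.univ : Finset (Fin 2))
            (F := ![fun y => partFun μ π (A.erase j) B y * e, fun _ => -1]) (by
              intro i _
              fin_cases i
              · exact hF.mul (BddMeasJet.const e)
              · exact BddMeasJet.const (-1)) {j} x
          simp only [Fin.sum_univ_two, Matrix.cons_val_zero, Matrix.cons_val_one] at h1
          simp only [sub_eq_add_neg]
          rw [h1, avg_mul_const hF, hstage]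
          congr 1
          exact (integral_const (-1)).symm
        rw [this]
        refine nrm_avg_le h0 hF1 fun y hy => ?_
        obtain ⟨d, hd, hd'⟩ := hex y
        rw [hd', hbase y hy, mul_assoc, he]
        simpa using hd
      obtain ⟨d, hd, hd'⟩ := hex x
      set dbar := partFun μ π A B x * e - 1 with hdb
      have hZ : partFun μ π A B x = (1 + dbar) * partFun μ π (A.erase j) (B.erase j) x := by
        rw [hdb]; linear_combination (-partFun μ π A B x) * he
      have hne : (partFun μ π A B x).2 ≠ 0 := by
        rw [hZ, Prod.snd_mul]
        refine mul_ne_zero ?_ hv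
        intro h
        have h1 : dbar.2 = -1 := by
          rw [Prod.snd_add, Prod.snd_one] at h; linear_combination h
        have h2 := norm_snd_le (N := m) hρ dbar
        rw [h1, norm_neg, norm_one] at h2
        linarith
      refine ⟨hne, ?_⟩
      obtain ⟨f, hf⟩ := exists_mul_eq_one (coeff_zero_partFun A B x) hne
      set q := partFun μ π (A.erase j) (B.erase j) x * f with hq
      have hq1 : (1 + dbar) * q = 1 := by
        rw [hq, ← mul_assoc, ← hZ, hf]
      have hqn := nrm_le_of_one_add_mul_eq_one hρ hη hdbar hq1
      have hT : partFun μ π (A.erase j) B x = (1 + (d - dbar) * q) * partFun μ π A B x := by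
        rw [hd', hq]
        have e1 : partFun μ π (A.erase j) (B.erase j) x * f * partFun μ π A B x =
          partFun μ π (A.erase j) (B.erase j) x := by rw [mul_assoc, mul_comm f, hf, mul_one]
        linear_combination (dbar - d) * e1 - hZ
      refine ⟨(d - dbar) * q, ?_, ?_, hT⟩
      · refine le_trans ?_ hθη
        calc _ ≤ nrm m ρ (d - dbar) * nrm m ρ q := nrm_mul_le hρ _ _
          _ ≤ (η + η) * (1 / (1 - η)) := by
              refine mul_le_mul ((nrm_sub_le h0 _ _).trans (add_le_add hd hdbar)) hqn
                (nrm_nonneg h0 _) ?_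
              have := (nrm_nonneg h0 _).trans hd
              linarith
          _ = _ := by ring
      · have h1 := coeff_zero_partFun (μ := μ) (π := π) (A.erase j) B x
        have h2 := coeff_zero_partFun (μ := μ) (π := π) A B x
        rw [hT, Prod.fst_mul] at h1
        rw [PowerSeries.X_dvd_iff]
        rw [PowerSeries.coeff_zero_eq_constantCoeff_apply] at h1 h2
        rw [map_mul, h2, mul_one, Prod.fst_add, map_add, Prod.fst_one, map_one] at h1
        linear_combination h1
    refine ⟨?_, fun j hj => (step j hj).2⟩
    rcases A.eq_empty_or_nonempty with rfl | ⟨j, hj⟩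
    · rw [partFun, avg_empty]
      exact Complex.exp_ne_zero _
    · exact (step j hj).1

/-- Tilted expectations of a function of the coordinates in `V`, the tilt acting through one factor
`1 + T` for each of them. -/
theorem RatioBound.nrm_avg_const_mul_le (hπ : IsBddDecomposition π) (hm : 0 < m)
    (hρ : 1 ≤ ρ) (hθ : 0 ≤ θ) (hB : RatioBound μ π m ρ θ Finset.univ) (x : ∀ i, Ω i) {e : Jet}
    (he : partFun μ π Finset.univ Finset.univ x * e = 1) {ψ : (∀ i, Ω i) → ℂ}
    (hψ : BddMeas ψ) {V : Finset (Fin n)} (hdep : DependsOn ψ (V : Set (Fin n))) {a : ℝ}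
    (ha : ∀ y, ‖ψ y‖ ≤ a) :
    nrm m ρ (avg μ Finset.univ (fun y => const (ψ y) * weight π Finset.univ y) x * e) ≤
      a * prodBound m ρ θ V.card := by
  have h0 : 0 ≤ ρ := by linarith
  refine hB.nrm_avg_mul_le h0 hπ subset_rfl x he (BddMeasJet.constJet hψ) V ?_ ?_
  · intro y z hyz
    rw [hdep fun i hi => hyz i fun h => (Finset.mem_sdiff.1 h).2 hi]
  · intro y _ T hT hT0
    rw [Finset.univ_inter] at *
    refine (nrm_mul_prod_one_add_le (d := 0) hρ (Nat.zero_le _) hm (by simp) V T hT hT0).trans ?_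
    exact mul_le_mul_of_nonneg_right ((nrm_const_le _).trans (ha y)) (prodBound_nonneg h0 hθ _)

end Model
end Jet

/-! ### Binomial moments of the interactions -/

section Gamma

variable {n : ℕ} {Ω : Fin n → Type*}

/-- Up to sign, `∂_y^V π(W, ·)` is `π(V ∪ W, ·)` with the coordinates in `V \ W` set to those
of `y`. -/
theorem norm_decompPartialSet (y : ∀ i, Ω i) (V W : Finset (Fin n))
    (π : Finset (Fin n) → (∀ i, Ω i) → ℂ) (x : ∀ i, Ω i) :
    ‖decompPartialSet y V π W x‖ = ‖π (V ∪ W) ((V \ W).piecewise y x)‖ := by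
  have key : ∀ (l : List (Fin n)) (W : Finset (Fin n)) (x : ∀ i, Ω i),
      ‖l.foldr (fun j ρ => decompPartial y j ρ) π W x‖ =
        ‖π (l.toFinset ∪ W) ((l.toFinset \ W).piecewise y x)‖ := by
    intro l
    induction l with
    | nil =>
      intro W x
      have : ((∅ : Finset (Fin n)) \ W).piecewise y x = x := by
        rw [Finset.empty_sdiff, Finset.piecewise_empty]
      rw [List.toFinset_nil, this, Finset.empty_union, List.foldr_nil]
    | cons a l ih =>
      intro W x
      by_cases h : a ∈ W
      · have : decompPartial y a (List.foldr (fun j ρ => decompPartial y j ρ) π l) W x =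
            List.foldr (fun j ρ => decompPartial y j ρ) π l W x := by
          simp [decompPartial, decompR, h]
        rw [List.foldr_cons, this, ih, List.toFinset_cons, Finset.insert_sdiff_of_mem _ h,
          Finset.insert_union, Finset.insert_eq_self.2 (Finset.mem_union_right _ h)]
      · have : decompPartial y a (List.foldr (fun j ρ => decompPartial y j ρ) π l) W x =
            -List.foldr (fun j ρ => decompPartial y j ρ) π l (insert a W)
              (Function.update x a (y a)) := by
          simp only [decompPartial, Pi.sub_apply, decompR, h, if_false]
          ring
        rw [List.foldr_cons, this, norm_neg, ih, List.toFinset_cons, Finset.union_insert,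
          Finset.insert_union]
        congr 2
        funext i
        rcases eq_or_ne i a with rfl | hi
        · simp [Finset.piecewise, h]
        · simp [Finset.piecewise, hi]
  have := key (V.sort (· ≤ ·)) W x
  rwa [Finset.sort_toFinset] at this

/-- The sup norm of a component of a decomposition. -/
def supNorm (π : Finset (Fin n) → (∀ i, Ω i) → ℂ) (V : Finset (Fin n)) : ℝ :=
  ⨆ x : ∀ i, Ω i, ‖π V x‖

theorem supNorm_nonneg (π : Finset (Fin n) → (∀ i, Ω i) → ℂ) (V : Finset (Fin n)) :
    0 ≤ supNorm π V :=
  Real.iSup_nonneg fun _ => norm_nonneg _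

theorem IsBddDecomposition.norm_le_supNorm [∀ i, MeasurableSpace (Ω i)]
    {π : Finset (Fin n) → (∀ i, Ω i) → ℂ} (hπ : IsBddDecomposition π) (V : Finset (Fin n))
    (x : ∀ i, Ω i) : ‖π V x‖ ≤ supNorm π V := by
  obtain ⟨C, hC⟩ := hπ.bounded V
  exact le_ciSup (f := fun x => ‖π V x‖) ⟨C, by rintro _ ⟨z, rfl⟩; exact hC _⟩ x

/-- The combined weight of an interaction `U` seen from a coordinate `j`: unconditionally and with
the `j`-th coordinate frozen. -/
def locWeight (γ : ℝ) (π : Finset (Fin n) → (∀ i, Ω i) → ℂ) (j : Fin n) (U : Finset (Fin n))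
    (y : ∀ i, Ω i) : ℝ :=
  supNorm π U * Real.exp (γ * (U.card : ℝ)) +
    Jet.condSup π j U y * Real.exp (γ * ((U.card - 1 : ℕ) : ℝ))

theorem locWeight_nonneg (γ : ℝ) (π : Finset (Fin n) → (∀ i, Ω i) → ℂ) (j : Fin n)
    (U : Finset (Fin n)) (y : ∀ i, Ω i) : 0 ≤ locWeight γ π j U y :=
  add_nonneg (mul_nonneg (supNorm_nonneg _ _) (Real.exp_pos _).le)
    (mul_nonneg (Jet.condSup_nonneg _ _ _ _) (Real.exp_pos _).le)

/-- The components of `∂_y^V π` with indices `U` and `U \ {j}`, for `U ⊇ V`, are up to sign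
`π(U, ·)` and `π(U, ·)` with the `j`-th coordinate set to `y_j`. -/
theorem sum_locWeight_le_decompNorm (γ : ℝ) (π : Finset (Fin n) → (∀ i, Ω i) → ℂ) {j : Fin n}
    {V : Finset (Fin n)} (hj : j ∈ V) (y : ∀ i, Ω i) :
    ∑ U : Finset (Fin n) with V ⊆ U, locWeight γ π j U y ≤
      decompNorm γ (decompPartialSet y V π) := by
  set g : Finset (Fin n) → ℝ := fun W =>
    (⨆ x : ∀ i, Ω i, ‖decompPartialSet y V π W x‖) * Real.exp (γ * (W.card : ℝ)) with hg
  have hg0 : ∀ W, 0 ≤ g W := fun W =>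
    mul_nonneg (Real.iSup_nonneg fun _ => norm_nonneg _) (Real.exp_pos _).le
  have h1 : ∀ U, V ⊆ U → supNorm π U * Real.exp (γ * (U.card : ℝ)) = g U := by
    intro U hU
    have e (x) : (V \ U).piecewise y x = x := by
      rw [Finset.sdiff_eq_empty_iff_subset.2 hU, Finset.piecewise_empty]
    simp only [hg, norm_decompPartialSet, supNorm, Finset.union_eq_right.2 hU, e]
  have h2 : ∀ U, V ⊆ U →
      Jet.condSup π j U y * Real.exp (γ * ((U.card - 1 : ℕ) : ℝ)) = g (U.erase j) := by
    intro U hU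
    have e1 : V ∪ U.erase j = U := by
      ext i
      simp only [Finset.mem_union, Finset.mem_erase]
      constructor
      · rintro (h | h)
        exacts [hU h, h.2]
      · intro h
        by_cases hi : i = j
        · exact Or.inl (hi ▸ hj)
        · exact Or.inr ⟨hi, h⟩
    have e2 : V \ U.erase j = {j} := by
      ext i
      simp only [Finset.mem_sdiff, Finset.mem_erase, Finset.mem_singleton]
      constructor
      · rintro ⟨h, h'⟩
        by_contra hi
        exact h' ⟨hi, hU h⟩
      · rintro rfl
        exact ⟨hj, by simp⟩
    have e (x) : (V \ U.erase j).piecewise y x = Function.update x j (y j) := by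
      rw [e2, Finset.piecewise_singleton]
    simp only [hg, norm_decompPartialSet, e1, e, Jet.condSup,
      Finset.card_erase_of_mem (hU hj)]
  calc ∑ U : Finset (Fin n) with V ⊆ U, locWeight γ π j U y
      = ∑ U : Finset (Fin n) with V ⊆ U, (g U + g (U.erase j)) := by
        refine Finset.sum_congr rfl fun U hU => ?_
        have := (Finset.mem_filter.1 hU).2
        rw [locWeight, h1 U this, h2 U this]
    _ ≤ ∑ U : Finset (Fin n) with j ∈ U, (g U + g (U.erase j)) := by
        refine Finset.sum_le_sum_of_subset_of_nonneg (fun U hU => ?_)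
          fun U _ _ => add_nonneg (hg0 _) (hg0 _)
        rw [Finset.mem_filter] at hU ⊢
        exact ⟨hU.1, hU.2 hj⟩
    _ = ∑ U : Finset (Fin n) with j ∈ U, g U + ∑ U : Finset (Fin n) with j ∉ U, g U := by
        rw [Finset.sum_add_distrib]
        congr 1
        refine Finset.sum_bij' (fun U _ => U.erase j) (fun U _ => insert j U) ?_ ?_ ?_ ?_ ?_
        · intro U _; simp
        · intro U _; simp
        · intro U hU; exact Finset.insert_erase (Finset.mem_filter.1 hU).2
        · intro U hU; exact Finset.erase_insert (Finset.mem_filter.1 hU).2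
        · intro U _; rfl
    _ = decompNorm γ (decompPartialSet y V π) :=
        Finset.sum_filter_add_sum_filter_not _ _ _

theorem choose_le_card_filter {j : Fin n} {U : Finset (Fin n)} (hj : j ∈ U) (k : ℕ) :
    (U.card - 1).choose k ≤
      ({V : Finset (Fin n) | (V.card = k + 1 ∧ j ∈ V) ∧ V ⊆ U} : Finset _).card := by
  rw [← Finset.card_erase_of_mem hj, ← Finset.card_powersetCard]
  refine Finset.card_le_card_of_injOn (fun V => insert j V) ?_ ?_
  · intro V hV
    have hV := Finset.mem_powersetCard.1 (Finset.mem_coe.1 hV)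
    have hjV : j ∉ V := fun h => Finset.notMem_erase j U (hV.1 h)
    simp only [Finset.coe_filter, Finset.mem_univ, true_and, Set.mem_ofPred_eq]
    exact ⟨⟨by rw [Finset.card_insert_of_notMem hjV, hV.2], Finset.mem_insert_self _ _⟩,
      Finset.insert_subset hj (hV.1.trans (Finset.erase_subset _ _))⟩
  · intro V hV W hW h
    have hV := Finset.mem_powersetCard.1 (Finset.mem_coe.1 hV)
    have hW := Finset.mem_powersetCard.1 (Finset.mem_coe.1 hW)
    have hjV : j ∉ V := fun h => Finset.notMem_erase j U (hV.1 h)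
    have hjW : j ∉ W := fun h => Finset.notMem_erase j U (hW.1 h)
    rw [← Finset.erase_insert hjV, ← Finset.erase_insert hjW]
    exact congrArg (·.erase j) h

/-- The hypothesis on the `Γ_{V,γ}` bounds binomial moments of the interaction sizes. -/
theorem sum_choose_mul_locWeight_le [∀ i, MeasurableSpace (Ω i)]
    {π : Finset (Fin n) → (∀ i, Ω i) → ℂ} (hπ : IsBddDecomposition π) {m : ℕ} {α γ : ℝ}
    (hΓ : ∀ t ∈ Finset.Icc 1 m, ∀ j : Fin n,
      ∑ V ∈ (Finset.univ : Finset (Finset (Fin n))) with V.card = t ∧ j ∈ V,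
        decompGamma V γ π ≤ α) (j : Fin n) (y : ∀ i, Ω i) {k : ℕ} (hk : k < m) :
    ∑ U : Finset (Fin n) with j ∈ U, ((U.card - 1).choose k : ℝ) * locWeight γ π j U y ≤ α := by
  refine le_trans ?_ (hΓ (k + 1) (Finset.mem_Icc.2 ⟨by omega, hk⟩) j)
  calc ∑ U : Finset (Fin n) with j ∈ U, ((U.card - 1).choose k : ℝ) * locWeight γ π j U y
      ≤ ∑ U : Finset (Fin n),
          ∑ V : Finset (Fin n) with (V.card = k + 1 ∧ j ∈ V) ∧ V ⊆ U, locWeight γ π j U y := by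
        refine (Finset.sum_le_sum fun U hU => ?_).trans
          (Finset.sum_le_sum_of_subset_of_nonneg (Finset.filter_subset _ _) fun U _ _ =>
            Finset.sum_nonneg fun V _ => locWeight_nonneg _ _ _ _ _)
        rw [Finset.sum_const, nsmul_eq_mul]
        refine mul_le_mul_of_nonneg_right ?_ (locWeight_nonneg _ _ _ _ _)
        exact_mod_cast choose_le_card_filter (Finset.mem_filter.1 hU).2 k
    _ = ∑ V : Finset (Fin n) with V.card = k + 1 ∧ j ∈ V,
          ∑ U : Finset (Fin n) with V ⊆ U, locWeight γ π j U y := by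
        refine Finset.sum_comm' fun U V => ?_
        simp only [Finset.mem_filter, Finset.mem_univ, true_and]
        exact and_comm
    _ ≤ _ := by
        refine Finset.sum_le_sum fun V hV => ?_
        refine (sum_locWeight_le_decompNorm γ π (Finset.mem_filter.1 hV).2.2 y).trans ?_
        exact le_ciSup (f := fun y => decompNorm γ (decompPartialSet y V π))
          (bddAbove_decompNorm_partialSet hπ V γ).2 y

end Gamma

namespace Jet

/-! ### Numerical bounds -/

/-- Only the binomial coefficients of order at most `N` are needed, the higher ones being absorbed
in the exponential weight. -/
theorem prodBound_le {ρ θ γ : ℝ} (hρ : 0 < ρ) (hθ : 0 ≤ θ) (hγ : θ / ρ ≤ γ) (N l : ℕ) :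
    prodBound N ρ θ l ≤
      Real.exp (γ * l) * ∑ k ∈ Finset.range (N + 1), (l.choose k : ℝ) * θ ^ k := by
  have hτ : 0 ≤ θ / ρ := by positivity
  have hγ0 : 0 ≤ γ := hτ.trans hγ
  have h1 : (1 + θ / ρ) ^ l ≤ Real.exp (γ * l) := by
    rw [mul_comm, Real.exp_nat_mul]
    have := Real.add_one_le_exp γ
    gcongr
    linarith
  have h2 : 1 ≤ Real.exp (γ * l) := Real.one_le_exp (by positivity)
  have hlow : ∑ k ∈ Finset.range (l + 1) with k < N, (l.choose k : ℝ) * prodWeight N ρ θ k ≤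
      Real.exp (γ * l) * ∑ k ∈ Finset.range N, (l.choose k : ℝ) * θ ^ k := by
    calc _ = ∑ k ∈ Finset.range (l + 1) with k < N, (l.choose k : ℝ) * θ ^ k := by
          refine Finset.sum_congr rfl fun k hk => ?_
          rw [prodWeight, if_pos (Finset.mem_filter.1 hk).2]
      _ ≤ ∑ k ∈ Finset.range N, (l.choose k : ℝ) * θ ^ k := by
          refine Finset.sum_le_sum_of_subset_of_nonneg (fun k hk => ?_) fun k _ _ => by positivity
          exact Finset.mem_range.2 (Finset.mem_filter.1 hk).2
      _ ≤ _ := le_mul_of_one_le_left (Finset.sum_nonneg fun k _ => by positivity) h2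
  have hhigh : ∑ k ∈ Finset.range (l + 1) with ¬ k < N, (l.choose k : ℝ) * prodWeight N ρ θ k ≤
      Real.exp (γ * l) * ((l.choose N : ℝ) * θ ^ N) := by
    calc _ = ρ ^ N * ∑ k ∈ Finset.range (l + 1) with N ≤ k, (l.choose k : ℝ) * (θ / ρ) ^ k := by
          rw [Finset.mul_sum]
          refine Finset.sum_congr (by simp only [not_lt]) fun k hk => ?_
          rw [prodWeight, if_neg (not_lt.2 (Finset.mem_filter.1 hk).2)]; ring
      _ ≤ ρ ^ N * ((l.choose N : ℝ) * (θ / ρ) ^ N * (1 + θ / ρ) ^ l) := by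
          gcongr
          exact sum_choose_mul_pow_le hτ l N
      _ = (1 + θ / ρ) ^ l * ((l.choose N : ℝ) * θ ^ N) := by
          rw [div_pow]; field_simp
      _ ≤ _ := by gcongr
  rw [prodBound, ← Finset.sum_filter_add_sum_filter_not _ (fun k => k < N), Finset.sum_range_succ,
    mul_add]
  exact add_le_add hlow hhigh

/-- Compared with `prodBound_le`, a factor `L + 1` is split off in exchange for one binomial order;
it is compensated by counting every set once for each of its elements. -/
theorem prodBound_succ_le {ρ θ γ : ℝ} (hρ : 0 < ρ) (hθ : 0 ≤ θ) (hγ : θ / ρ ≤ γ) (N L : ℕ) :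
    prodBound N ρ θ (L + 1) ≤ ((L + 1 : ℕ) : ℝ) * (Real.exp (γ * ((L + 1 : ℕ) : ℝ)) *
      (1 + θ * ∑ k ∈ Finset.range N, (L.choose k : ℝ) * θ ^ k)) := by
  refine (prodBound_le hρ hθ hγ N (L + 1)).trans ?_
  rw [mul_left_comm]
  gcongr
  rw [Finset.sum_range_succ', mul_add, mul_one, add_comm, Finset.mul_sum, Finset.mul_sum]
  refine add_le_add (by simp) (Finset.sum_le_sum fun k _ => ?_)
  have h2 : (L + 1).choose (k + 1) ≤ (L + 1) * L.choose k := by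
    rw [Nat.add_one_mul_choose_eq]
    exact Nat.le_mul_of_pos_right _ (Nat.succ_pos k)
  have h3 : ((L + 1).choose (k + 1) : ℝ) ≤ ((L + 1 : ℕ) : ℝ) * L.choose k := by exact_mod_cast h2
  calc ((L + 1).choose (k + 1) : ℝ) * θ ^ (k + 1)
      ≤ (((L + 1 : ℕ) : ℝ) * L.choose k) * θ ^ (k + 1) := by gcongr
    _ = _ := by rw [pow_succ]; ring

theorem sum_mul_geom_le {ι : Type*} (s : Finset ι) (a : ι → ℝ) (L : ι → ℕ) {m : ℕ} {β θ : ℝ}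
    (hβ : 0 ≤ β) (hθ : 0 ≤ θ) (hθ1 : θ < 1)
    (h : ∀ k < m, ∑ i ∈ s, ((L i).choose k : ℝ) * a i ≤ β) :
    ∑ i ∈ s, a i * ∑ k ∈ Finset.range m, ((L i).choose k : ℝ) * θ ^ k ≤ β / (1 - θ) := by
  calc ∑ i ∈ s, a i * ∑ k ∈ Finset.range m, ((L i).choose k : ℝ) * θ ^ k
      = ∑ k ∈ Finset.range m, (∑ i ∈ s, ((L i).choose k : ℝ) * a i) * θ ^ k := by
        simp only [Finset.mul_sum, Finset.sum_mul]
        rw [Finset.sum_comm]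
        exact Finset.sum_congr rfl fun _ _ => Finset.sum_congr rfl fun _ _ => by ring
    _ ≤ ∑ k ∈ Finset.range m, β * θ ^ k := by
        refine Finset.sum_le_sum fun k hk => ?_
        have := h k (Finset.mem_range.1 hk)
        gcongr
    _ ≤ β / (1 - θ) := by
        rw [← Finset.mul_sum, div_eq_mul_inv]
        gcongr
        rw [← tsum_geometric_of_lt_one hθ hθ1]
        exact (summable_geometric_of_lt_one hθ hθ1).sum_le_tsum _ fun _ _ => by positivity

variable {n : ℕ} {Ω : Fin n → Type*} {π : Finset (Fin n) → (∀ i, Ω i) → ℂ}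

/-- The sum over all interactions is distributed over their elements, which saves one binomial
order: at order `m` the moments below `m` suffice. -/
theorem sum_supNorm_mul_prodBound_le {m : ℕ} {ρ α γ : ℝ} (x : ∀ i, Ω i)
    (hm : 0 < m) (hρ : 1 ≤ ρ) (hα : 0 ≤ α) (hγ : 3 / 20 / ρ ≤ γ)
    (H : ∀ j, ∀ y : ∀ i, Ω i, ∀ k < m, ∑ U : Finset (Fin n) with j ∈ U,
      ((U.card - 1).choose k : ℝ) * locWeight γ π j U y ≤ α) :
    ∑ V ∈ (Finset.univ : Finset (Finset (Fin n))).erase ∅,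
      supNorm π V * prodBound m ρ (3 / 20) V.card ≤ n * (20 / 17 * α) := by
  have h0 : 0 < ρ := by linarith
  set q : Finset (Fin n) → ℝ := fun V => supNorm π V * Real.exp (γ * (V.card : ℝ)) *
    (1 + 3 / 20 * ∑ k ∈ Finset.range m, ((V.card - 1).choose k : ℝ) * (3 / 20) ^ k) with hq
  have hq0 : ∀ V, 0 ≤ q V := fun V => by
    have := supNorm_nonneg π V
    have : 0 ≤ ∑ k ∈ Finset.range m, ((V.card - 1).choose k : ℝ) * (3 / 20 : ℝ) ^ k :=
      Finset.sum_nonneg fun _ _ => by positivity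
    positivity
  have hS : ∀ j, ∀ k < m, ∑ U : Finset (Fin n) with j ∈ U,
      ((U.card - 1).choose k : ℝ) * (supNorm π U * Real.exp (γ * (U.card : ℝ))) ≤ α := by
    intro j k hk
    refine le_trans (Finset.sum_le_sum fun U _ => ?_) (H j x k hk)
    refine mul_le_mul_of_nonneg_left ?_ (Nat.cast_nonneg _)
    exact le_add_of_nonneg_right (mul_nonneg (condSup_nonneg _ _ _ _) (Real.exp_pos _).le)
  calc _ ≤ ∑ V ∈ (Finset.univ : Finset (Finset (Fin n))).erase ∅, ∑ j ∈ V, q V := by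
        refine Finset.sum_le_sum fun V hV => ?_
        have hV' := Finset.card_pos.2 (Finset.nonempty_iff_ne_empty.2 (Finset.ne_of_mem_erase hV))
        have h1 := prodBound_succ_le h0 (by norm_num) hγ m (V.card - 1)
        rw [Nat.sub_add_cancel hV'] at h1
        rw [Finset.sum_const, nsmul_eq_mul]
        refine (mul_le_mul_of_nonneg_left h1 (supNorm_nonneg π V)).trans (le_of_eq ?_)
        rw [hq]; ring
    _ ≤ ∑ V : Finset (Fin n), ∑ j ∈ V, q V :=
        Finset.sum_le_sum_of_subset_of_nonneg (Finset.erase_subset _ _)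
          fun V _ _ => Finset.sum_nonneg fun _ _ => hq0 V
    _ = ∑ j : Fin n, ∑ V : Finset (Fin n) with j ∈ V, q V := by
        refine Finset.sum_comm' fun V j => ?_
        simp
    _ ≤ ∑ j : Fin n, 20 / 17 * α := by
        refine Finset.sum_le_sum fun j _ => ?_
        have h1 := hS j 0 hm
        simp only [Nat.choose_zero_right, Nat.cast_one, one_mul] at h1
        have h2 := sum_mul_geom_le _ _ _ hα (by norm_num) (by norm_num) (hS j) (θ := 3 / 20)
        calc ∑ V : Finset (Fin n) with j ∈ V, q V
            = ∑ V : Finset (Fin n) with j ∈ V, supNorm π V * Real.exp (γ * (V.card : ℝ)) +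
              3 / 20 * ∑ V : Finset (Fin n) with j ∈ V,
                supNorm π V * Real.exp (γ * (V.card : ℝ)) *
                ∑ k ∈ Finset.range m, ((V.card - 1).choose k : ℝ) * (3 / 20) ^ k := by
              rw [Finset.mul_sum, ← Finset.sum_add_distrib]
              refine Finset.sum_congr rfl fun V _ => ?_
              rw [hq]; ring
          _ ≤ α + 3 / 20 * (α / (1 - 3 / 20)) := by gcongr
          _ = _ := by ring
    _ = _ := by simp

variable [∀ i, MeasurableSpace (Ω i)]

theorem condSup_le_supNorm (hπ : IsBddDecomposition π) (j : Fin n) (V : Finset (Fin n))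
    (x : ∀ i, Ω i) : condSup π j V x ≤ supNorm π V :=
  have : Nonempty (∀ i, Ω i) := ⟨x⟩
  ciSup_le fun _ => hπ.norm_le_supNorm V _

/-- Both parts of `locWeight` dominate the conditional weight. This factor `2` is what makes
`γ ≥ 3 α / 2` sufficient. -/
theorem two_mul_condSup_le_locWeight {γ : ℝ} (hγ : 0 ≤ γ) (hπ : IsBddDecomposition π) (j : Fin n)
    (V : Finset (Fin n)) (x : ∀ i, Ω i) :
    2 * (condSup π j V x * Real.exp (γ * ((V.card - 1 : ℕ) : ℝ))) ≤ locWeight γ π j V x := by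
  rw [locWeight, two_mul]
  have h1 := condSup_le_supNorm hπ j V x
  have h2 := condSup_nonneg π j V x
  have h3 : ((V.card - 1 : ℕ) : ℝ) ≤ V.card := by exact_mod_cast Nat.sub_le _ _
  have h4 := supNorm_nonneg π V
  gcongr

/-- The constants: `ρ α ≤ 1 / 10` and `θ = 3 / 20` give
`(21 / 20) (ρ α / 2) / (1 - θ) ≤ 21 / 340`. -/
theorem sum_exp_sub_one_mul_prodBound_le {m : ℕ} {ρ α γ : ℝ} (hπ : IsBddDecomposition π)
    (hm : 0 < m) (hρ : 1 ≤ ρ) (hα : 0 ≤ α) (hρα : ρ * α ≤ 1 / 10) (hγ : 3 / 20 / ρ ≤ γ)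
    (H : ∀ j, ∀ y : ∀ i, Ω i, ∀ k < m, ∑ U : Finset (Fin n) with j ∈ U,
      ((U.card - 1).choose k : ℝ) * locWeight γ π j U y ≤ α) (j : Fin n) (x : ∀ i, Ω i) :
    ∑ V : Finset (Fin n) with j ∈ V,
      (Real.exp (ρ * condSup π j V x) - 1) * prodBound (m - 1) ρ (3 / 20) (V.card - 1) ≤
        21 / 340 := by
  have h0 : 0 < ρ := by linarith
  have hγ0 : 0 ≤ γ := le_trans (by positivity) hγ
  have hc : ∀ V ∈ ({V | j ∈ V} : Finset (Finset (Fin n))), ρ * condSup π j V x ≤ 1 / 20 := by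
    intro V hV
    have h1 := H j x 0 hm
    simp only [Nat.choose_zero_right, Nat.cast_one, one_mul] at h1
    have h2 := (Finset.single_le_sum (f := fun U => locWeight γ π j U x)
      (fun U _ => locWeight_nonneg γ π j U x) hV).trans h1
    have h3 := two_mul_condSup_le_locWeight hγ0 hπ j V x
    have h4 : condSup π j V x ≤ condSup π j V x * Real.exp (γ * ((V.card - 1 : ℕ) : ℝ)) :=
      le_mul_of_one_le_right (condSup_nonneg _ _ _ _) (Real.one_le_exp (by positivity))
    have h5 : condSup π j V x ≤ α / 2 := by linarith
    calc ρ * condSup π j V x ≤ ρ * (α / 2) := by gcongr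
      _ ≤ 1 / 20 := by linarith
  calc _ ≤ ∑ V : Finset (Fin n) with j ∈ V, 21 / 40 * ρ * (locWeight γ π j V x *
          ∑ k ∈ Finset.range m, ((V.card - 1).choose k : ℝ) * (3 / 20) ^ k) := by
        refine Finset.sum_le_sum fun V hV => ?_
        have hu := hc V hV
        have hs := condSup_nonneg π j V x
        have hu0 : 0 ≤ ρ * condSup π j V x := by positivity
        have h1 : Real.exp (ρ * condSup π j V x) - 1 ≤ 21 / 20 * (ρ * condSup π j V x) := by
          have := (abs_le.1 (Real.abs_exp_sub_one_sub_id_le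
            (x := ρ * condSup π j V x) (by rw [abs_of_nonneg hu0]; linarith))).2
          nlinarith
        have h2 := prodBound_le h0 (by norm_num) hγ (m - 1) (V.card - 1)
        rw [Nat.sub_add_cancel hm] at h2
        have h3 := two_mul_condSup_le_locWeight hγ0 hπ j V x
        set Q := ∑ k ∈ Finset.range m, ((V.card - 1).choose k : ℝ) * (3 / 20) ^ k with hQ
        have hQ0 : 0 ≤ Q := Finset.sum_nonneg fun _ _ => by positivity
        calc _ ≤ 21 / 20 * (ρ * condSup π j V x) *
              (Real.exp (γ * ((V.card - 1 : ℕ) : ℝ)) * Q) :=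
              mul_le_mul h1 h2 (prodBound_nonneg h0.le (by norm_num) _) (by positivity)
          _ = 21 / 40 * ρ * ((2 * (condSup π j V x *
                Real.exp (γ * ((V.card - 1 : ℕ) : ℝ)))) * Q) := by ring
          _ ≤ _ := by gcongr
    _ ≤ 21 / 40 * ρ * (α / (1 - 3 / 20)) := by
        rw [← Finset.mul_sum]
        gcongr
        exact sum_mul_geom_le _ _ _ hα (by norm_num) (by norm_num) (H j x)
    _ ≤ _ := by
        have : 21 / 40 * ρ * (α / (1 - 3 / 20)) = 21 / 34 * (ρ * α) := by ring
        rw [this]; linarith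

/-- The fixed point condition of `ratioBound` holds for `G = 21 / 340` and `θ = 3 / 20`, also for
the decompositions dominated by `π`, such as `w • π` with `w ∈ [0, 1]`. -/
theorem ratioBound_of_sum_locWeight_le {μ : ∀ i, Measure (Ω i)}
    [∀ i, IsProbabilityMeasure (μ i)] {m : ℕ} {ρ α γ : ℝ} (hπ : IsBddDecomposition π)
    (hm : 0 < m) (hρ : 1 ≤ ρ) (hα : 0 ≤ α) (hρα : ρ * α ≤ 1 / 10) (hγ : 3 / 20 / ρ ≤ γ)
    (H : ∀ j, ∀ y : ∀ i, Ω i, ∀ k < m, ∑ U : Finset (Fin n) with j ∈ U,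
      ((U.card - 1).choose k : ℝ) * locWeight γ π j U y ≤ α)
    {π' : Finset (Fin n) → (∀ i, Ω i) → ℂ} (hπ' : IsBddDecomposition π')
    (hle : ∀ j V x, condSup π' j V x ≤ condSup π j V x) (B : Finset (Fin n)) :
    RatioBound μ π' m ρ (3 / 20) B := by
  have hη := (abs_le.1 (Real.abs_exp_sub_one_sub_id_le
    (x := 21 / 340) (by rw [abs_of_nonneg] <;> norm_num))).2
  refine ratioBound (G := 21 / 340) hπ' hm hρ (by norm_num) (fun j x => ?_) (by linarith) ?_ B
  · refine le_trans (Finset.sum_le_sum fun V _ => ?_)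
      (sum_exp_sub_one_mul_prodBound_le hπ hm hρ hα hρα hγ H j x)
    have := hle j V x
    gcongr
    exact prodBound_nonneg (by linarith) (by norm_num) _
  · rw [div_le_iff₀ (by linarith)]
    linarith

/-! ### Logarithmic derivative of the moment generating function -/

theorem _root_.derivative_eq_mul_derivative_logOf {f : PowerSeries ℂ}
    (hf : PowerSeries.constantCoeff f = 1) :
    PowerSeries.derivative ℂ f = f * PowerSeries.derivative ℂ (PowerSeries.logOf f) := by
  have hL : PowerSeries.HasSubst (PowerSeries.logOf f) :=
    PowerSeries.HasSubst.of_constantCoeff_zero' (PowerSeries.constantCoeff_logOf hf)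
  have h1 : PowerSeries.derivative ℂ ((PowerSeries.exp ℂ).subst (PowerSeries.logOf f)) =
      (PowerSeries.exp ℂ).subst (PowerSeries.logOf f) *
        PowerSeries.derivative ℂ (PowerSeries.logOf f) := by
    rw [PowerSeries.derivative_subst hL, PowerSeries.derivative_exp]
  rwa [exp_subst_logOf hf] at h1

theorem const_sum {ι : Type*} (s : Finset ι) (c : ι → ℂ) :
    const (∑ i ∈ s, c i) = ∑ i ∈ s, const (c i) := by
  refine Prod.ext ?_ ?_
  · simp [const, Prod.fst_sum]
  · simp [const, Prod.snd_sum]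

/-- Uniformly in `w ∈ [0, 1]`, the logarithmic derivative of `w ↦ ∫ exp (w f_π)` is, up to a
constant, a jet of small norm. -/
theorem exists_nrm_logDeriv_sub_const_le {μ : ∀ i, Measure (Ω i)}
    [∀ i, IsProbabilityMeasure (μ i)] {m : ℕ} {ρ α γ : ℝ} (hπ : IsBddDecomposition π)
    (hm : 0 < m) (hρ : 1 ≤ ρ) (hα : 0 ≤ α) (hρα : ρ * α ≤ 1 / 10) (hγ : 3 / 20 / ρ ≤ γ)
    (H : ∀ j, ∀ y : ∀ i, Ω i, ∀ k < m, ∑ U : Finset (Fin n) with j ∈ U,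
      ((U.card - 1).choose k : ℝ) * locWeight γ π j U y ≤ α)
    {w : ℝ} (hw : w ∈ Set.Icc (0 : ℝ) 1) :
    ∫ y, Complex.exp (w * decompFun π y) ∂Measure.pi μ ≠ 0 ∧ ∃ c : ℂ,
      nrm m ρ ((PowerSeries.rescale (w : ℂ) (PowerSeries.derivative ℂ
          (PowerSeries.logOf (momentSeries (Measure.pi μ) (decompFun π)))),
        (∫ y, decompFun π y * Complex.exp (w * decompFun π y) ∂Measure.pi μ) /
          ∫ y, Complex.exp (w * decompFun π y) ∂Measure.pi μ) - const c) ≤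
        n * (20 / 17 * α) := by
  have h0 : 0 ≤ ρ := by linarith
  set ν := Measure.pi μ with hν
  set f := decompFun π with hf
  obtain ⟨x⟩ : Nonempty (∀ i, Ω i) := ν.nonempty_of_neZero
  set πw : Finset (Fin n) → (∀ i, Ω i) → ℂ := fun V x => w * π V x with hπw
  have hnorm : ∀ V x, ‖πw V x‖ ≤ ‖π V x‖ := by
    intro V x
    rw [hπw, norm_mul, Complex.norm_real, Real.norm_of_nonneg hw.1]
    exact mul_le_of_le_one_left (norm_nonneg _) hw.2
  have hπ' : IsBddDecomposition πw := by
    refine ⟨fun V y z h => ?_, fun V => (hπ.measurable V).const_mul _, fun V => ?_⟩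
    · simp only [hπw, hπ.dependsOn V h]
    · obtain ⟨C, hC⟩ := hπ.bounded V
      exact ⟨C, fun x => (hnorm V x).trans (hC x)⟩
  have hB := ratioBound_of_sum_locWeight_le (μ := μ) hπ hm hρ hα hρα hγ H hπ'
    (fun j V y => by
      obtain ⟨C, hC⟩ := hπ.bounded V
      exact ciSup_mono ⟨C, by rintro _ ⟨z, rfl⟩; exact hC _⟩ fun z => hnorm V _) Finset.univ
  have hweight : ∀ y, weight πw Finset.univ y = expo (w * f y) := by
    intro y
    rw [weight, Finset.powerset_univ, hf, decompFun, Finset.mul_sum]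
  have hfb : BddMeas f := BddMeas.sum _ fun V _ => hπ.bddMeas V
  have hfac : ∀ k : ℕ, (k.factorial : ℂ) ≠ 0 := fun k => by exact_mod_cast k.factorial_ne_zero
  have havg : ∀ F : (∀ i, Ω i) → Jet, avg μ Finset.univ F x = integral ν F := by
    intro F; simp [avg, hν]
  set Z := partFun μ πw Finset.univ Finset.univ x with hZ
  have hZ' : Z = (PowerSeries.rescale (w : ℂ) (momentSeries ν f),
      ∫ y, Complex.exp (w * f y) ∂ν) := by
    rw [hZ, partFun, havg]
    refine Prod.ext ?_ ?_
    · ext k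
      simp only [integral, hweight, coeff_expo, PowerSeries.coeff_mk, PowerSeries.coeff_rescale,
        momentSeries, mul_pow, MeasureTheory.integral_div, MeasureTheory.integral_const_mul]
      rw [mul_div_assoc]
    · simp [integral, hweight, expo]
  set M := momentSeries ν f with hM
  have hM1 : PowerSeries.constantCoeff M = 1 := constantCoeff_momentSeries ν f
  set D := PowerSeries.derivative ℂ (PowerSeries.logOf M) with hD
  set N := avg μ Finset.univ (fun y => const (f y) * weight πw Finset.univ y) x with hN
  have hN' : N = (PowerSeries.rescale (w : ℂ) (PowerSeries.derivative ℂ M),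
      ∫ y, f y * Complex.exp (w * f y) ∂ν) := by
    rw [hN, havg]
    refine Prod.ext ?_ ?_
    · ext k
      have hk : ((k + 1).factorial : ℂ) = ((k : ℂ) + 1) * (k.factorial : ℂ) := by
        rw [Nat.factorial_succ]; push_cast; ring
      have hk0 : (k : ℂ) + 1 ≠ 0 := by exact_mod_cast k.succ_ne_zero
      have e1 : ∀ y, PowerSeries.coeff k (const (f y) * expo (w * f y)).1 =
          (w : ℂ) ^ k / (k.factorial : ℂ) * f y ^ (k + 1) := by
        intro y
        rw [Prod.fst_mul, const, PowerSeries.coeff_C_mul, coeff_expo, mul_pow, pow_succ]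
        ring
      simp only [integral, hweight, PowerSeries.coeff_mk, e1, MeasureTheory.integral_const_mul,
        PowerSeries.coeff_rescale, PowerSeries.coeff_derivative, hM, momentSeries, hk]
      have := hfac k
      field_simp
    · simp [integral, hweight, expo, const]
  have hZ2 : Z.2 ≠ 0 := (hB _ subset_rfl x).1
  obtain ⟨e, he⟩ := exists_mul_eq_one
    (coeff_zero_partFun (μ := μ) (π := πw) Finset.univ Finset.univ x) hZ2
  rw [← hZ] at he
  have hNe : N * e = (PowerSeries.rescale (w : ℂ) D,
      (∫ y, f y * Complex.exp (w * f y) ∂ν) / ∫ y, Complex.exp (w * f y) ∂ν) := by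
    have he1 := congrArg Prod.fst he
    have he2 := congrArg Prod.snd he
    rw [hZ'] at he1 he2 hZ2
    rw [Prod.fst_mul, Prod.fst_one] at he1
    rw [Prod.snd_mul, Prod.snd_one] at he2
    rw [hN']
    refine Prod.ext ?_ ?_
    · simp only [Prod.fst_mul]
      rw [derivative_eq_mul_derivative_logOf hM1, map_mul, ← hD]
      simp only at he1
      linear_combination PowerSeries.rescale (w : ℂ) D * he1
    · simp only [Prod.snd_mul]
      simp only at he2 hZ2
      rw [eq_div_iff hZ2]
      linear_combination (∫ y, f y * Complex.exp (w * f y) ∂ν) * he2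
  refine ⟨by rw [hZ'] at hZ2; exact hZ2, π ∅ x, ?_⟩
  rw [← hNe]
  have hwb := bddMeasJet_weight hπ' Finset.univ
  have hterm : ∀ V, BddMeasJet fun y => const (π V y) * weight πw Finset.univ y := fun V =>
    (BddMeasJet.constJet (hπ.bddMeas V)).mul hwb
  have hsum : N * e = ∑ V : Finset (Fin n),
      avg μ Finset.univ (fun y => const (π V y) * weight πw Finset.univ y) x * e := by
    rw [← Finset.sum_mul, ← avg_sum _ fun V _ => hterm V, hN]
    congr 2
    funext y
    rw [← Finset.sum_mul, ← const_sum]; rfl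
  have hempty : avg μ Finset.univ (fun y => const (π ∅ y) * weight πw Finset.univ y) x * e =
      const (π ∅ x) := by
    have e1 : ∀ y, π ∅ y = π ∅ x := fun y => hπ.dependsOn ∅ (by simp)
    have e2 : avg μ Finset.univ (fun y => const (π ∅ y) * weight πw Finset.univ y) x =
        Z * const (π ∅ x) := by
      rw [hZ, partFun, ← avg_mul_const hwb]
      congr 1
      funext y
      rw [e1 y, mul_comm]
    rw [e2, mul_right_comm, he, one_mul]
  rw [hsum, ← Finset.add_sum_erase _ _ (Finset.mem_univ ∅), hempty, add_sub_cancel_left]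
  refine (nrm_sum_le h0 _ _).trans (le_trans (Finset.sum_le_sum fun V _ => ?_)
    (sum_supNorm_mul_prodBound_le x hm hρ hα hγ H))
  exact hB.nrm_avg_const_mul_le hπ' hm hρ (by norm_num) x he (hπ.bddMeas V)
    (hπ.dependsOn V) (hπ.norm_le_supNorm V)

end Jet

/-! ### The cumulant expansion -/

/-- A solution of `H' = ε H` on `[0, 1]` changes by a factor `exp λ` with `|λ| ≤ sup |ε|`. -/
theorem exists_eq_mul_exp_of_hasDerivAt {H ε : ℝ → ℂ} {b : ℝ}
    (hH : ∀ w ∈ Set.Icc (0 : ℝ) 1, HasDerivAt H (ε w * H w) w)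
    (hε : ContinuousOn ε (Set.Icc 0 1)) (hb : ∀ w ∈ Set.Icc (0 : ℝ) 1, ‖ε w‖ ≤ b) :
    ∃ l : ℂ, ‖l‖ ≤ b ∧ H 1 = H 0 * Complex.exp l := by
  set ε' : ℝ → ℂ := Set.IccExtend zero_le_one ((Set.Icc (0 : ℝ) 1).domRestrict ε) with hε'
  have hc : Continuous ε' := (continuousOn_iff_continuous_domRestrict.1 hε).Icc_extend'
  have heq : ∀ w ∈ Set.Icc (0 : ℝ) 1, ε' w = ε w := fun w hw => by
    rw [hε', Set.IccExtend_of_mem _ _ hw]; rfl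
  set Λ : ℝ → ℂ := fun w => ∫ t in (0 : ℝ)..w, ε' t with hΛ
  have hΛ' : ∀ w, HasDerivAt Λ (ε' w) w := fun w =>
    intervalIntegral.integral_hasDerivAt_right (hc.intervalIntegrable _ _)
      (hc.stronglyMeasurableAtFilter _ _) hc.continuousAt
  have hK : ∀ w ∈ Set.Icc (0 : ℝ) 1, HasDerivAt (fun w => H w * Complex.exp (-Λ w)) 0 w := by
    intro w hw
    have := (hH w hw).mul ((hΛ' w).neg.cexp)
    rw [heq w hw] at this
    refine this.congr_deriv ?_
    simp only [Pi.neg_apply]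
    ring
  have hconst := constant_of_has_deriv_right_zero (a := 0) (b := 1)
    (fun w hw => (hK w hw).continuousAt.continuousWithinAt)
    (fun w hw => (hK w ⟨hw.1, hw.2.le⟩).hasDerivWithinAt) 1 (Set.right_mem_Icc.2 zero_le_one)
  refine ⟨Λ 1, ?_, ?_⟩
  · have := intervalIntegral.norm_integral_le_of_norm_le_const (a := 0) (b := 1) (C := b)
      (f := ε') (fun w hw => by
        rw [Set.uIoc_of_le zero_le_one] at hw
        have hw' : w ∈ Set.Icc (0 : ℝ) 1 := ⟨hw.1.le, hw.2⟩
        rw [heq w hw']; exact hb w hw')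
    simpa using this
  · simp only [hΛ, intervalIntegral.integral_same, neg_zero, Complex.exp_zero, mul_one] at hconst
    rw [← hconst, mul_assoc, ← Complex.exp_add]
    simp [hΛ]

theorem norm_mul_exp_le {c : ℂ} {C v w : ℝ} (hc : ‖c‖ ≤ C) (hv : |v - w| < 1) :
    ‖c * Complex.exp (v * c)‖ ≤ C * Real.exp ((|w| + 1) * C) := by
  have hC0 : 0 ≤ C := (norm_nonneg _).trans hc
  have hv' : |v| ≤ |w| + 1 := by linarith [abs_sub_abs_le_abs_sub v w]
  rw [norm_mul]
  refine mul_le_mul hc ?_ (norm_nonneg _) hC0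
  rw [Complex.norm_exp]
  refine Real.exp_le_exp.2 ((Complex.re_le_norm _).trans ?_)
  rw [norm_mul, Complex.norm_real, Real.norm_eq_abs]
  exact mul_le_mul hv' hc (norm_nonneg _) (by positivity)

theorem BddMeas.hasDerivAt_integral_exp {S : Type*} [MeasurableSpace S] {f : S → ℂ}
    (hf : BddMeas f) (P : Measure S) [IsProbabilityMeasure P] (w : ℝ) :
    HasDerivAt (fun w : ℝ => ∫ s, Complex.exp (w * f s) ∂P)
      (∫ s, f s * Complex.exp (w * f s) ∂P) w := by
  obtain ⟨hm, C, hC⟩ := id hf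
  have hE : ∀ w : ℝ, BddMeas fun s => Complex.exp (w * f s) := fun w =>
    ((BddMeas.const (w : ℂ)).mul hf).cexp
  refine (hasDerivAt_integral_of_dominated_loc_of_deriv_le (μ := P)
    (F := fun (w : ℝ) s => Complex.exp (w * f s))
    (F' := fun (w : ℝ) s => f s * Complex.exp (w * f s)) (x₀ := w)
    (bound := fun _ => C * Real.exp ((|w| + 1) * C)) (Metric.ball_mem_nhds w one_pos)
    (Filter.Eventually.of_forall fun w => (hE w).1.aestronglyMeasurable)
    ((hE w).integrable P) (hf.mul (hE w)).1.aestronglyMeasurable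
    (Filter.Eventually.of_forall fun s v hv => ?_) (integrable_const _)
    (Filter.Eventually.of_forall fun s v _ => ?_)).2
  · exact norm_mul_exp_le (hC s) (by simpa [Real.dist_eq] using hv)
  · have h1 : HasDerivAt (fun v : ℝ => (v : ℂ) * f s) (f s) v := by
      simpa using (Complex.ofRealCLM.hasDerivAt (x := v)).mul_const (f s)
    simpa [mul_comm] using h1.cexp

namespace Jet

variable {n : ℕ} {Ω : Fin n → Type*} [∀ i, MeasurableSpace (Ω i)]
  {π : Finset (Fin n) → (∀ i, Ω i) → ℂ}

theorem cumulantOf_succ {S : Type*} [MeasurableSpace S] (P : Measure S) (W : S → ℂ) (k : ℕ) :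
    cumulantOf P W (k + 1) = (k.factorial : ℂ) * PowerSeries.coeff k
      (PowerSeries.derivative ℂ (PowerSeries.logOf (momentSeries P W))) := by
  rw [cumulantOf, PowerSeries.coeff_derivative, Nat.factorial_succ]
  push_cast; ring

/-- The cumulant bounds and the cumulant expansion at a free scale `ρ`. -/
theorem cumulant_expansion {μ : ∀ i, Measure (Ω i)}
    [∀ i, IsProbabilityMeasure (μ i)] {m : ℕ} {ρ α γ : ℝ} (hπ : IsBddDecomposition π)
    (hm : 0 < m) (hρ : 1 ≤ ρ) (hα : 0 ≤ α) (hρα : ρ * α ≤ 1 / 10) (hγ : 3 / 20 / ρ ≤ γ)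
    (H : ∀ j, ∀ y : ∀ i, Ω i, ∀ k < m, ∑ U : Finset (Fin n) with j ∈ U,
      ((U.card - 1).choose k : ℝ) * locWeight γ π j U y ≤ α) :
    (∃ l : ℂ, ‖l‖ * ρ ^ m ≤ n * (20 / 17 * α) ∧
      ∫ y, Complex.exp (decompFun π y) ∂Measure.pi μ =
        Complex.exp l * Complex.exp (∑ r ∈ Finset.Icc 1 m,
          cumulantOf (Measure.pi μ) (decompFun π) r / (r.factorial : ℂ))) ∧
    ∀ k, 0 < k → k < m → ‖cumulantOf (Measure.pi μ) (decompFun π) (k + 1)‖ * ρ ^ k ≤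
      k.factorial * (n * (20 / 17 * α)) := by
  have h0 : 0 < ρ := by linarith
  set ν := Measure.pi μ with hν
  set f := decompFun π with hf
  have hfb : BddMeas f := BddMeas.sum _ fun V _ => hπ.bddMeas V
  set b : ℝ := n * (20 / 17 * α) with hb
  set D := PowerSeries.derivative ℂ (PowerSeries.logOf (momentSeries ν f)) with hD
  have key := fun w hw => exists_nrm_logDeriv_sub_const_le (μ := μ) hπ hm hρ hα hρα hγ H
    (w := w) hw
  rw [← hν, ← hf, ← hD, ← hb] at key
  refine ⟨?_, fun k hk0 hk => ?_⟩
  · set Z : ℝ → ℂ := fun w => ∫ y, Complex.exp (w * f y) ∂ν with hZ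
    set Z' : ℝ → ℂ := fun w => ∫ y, f y * Complex.exp (w * f y) ∂ν with hZ'
    have hZd : ∀ w, HasDerivAt Z (Z' w) w := fun w => hfb.hasDerivAt_integral_exp ν w
    set ε : ℝ → ℂ := fun w => Z' w / Z w -
      ∑ k ∈ Finset.range m, (w : ℂ) ^ k * PowerSeries.coeff k D with hε
    -- the truncated cumulant series, whose derivative is the sum subtracted in `ε`
    set p : ℝ → ℂ := fun w =>
      ∑ k ∈ Finset.range m, (w : ℂ) ^ (k + 1) * (PowerSeries.coeff k D / ((k : ℂ) + 1)) with hp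
    have hpd : ∀ w : ℝ, HasDerivAt p
        (∑ k ∈ Finset.range m, (w : ℂ) ^ k * PowerSeries.coeff k D) w := by
      intro w
      refine HasDerivAt.fun_sum fun k _ => ?_
      have hk0 : (k : ℂ) + 1 ≠ 0 := by exact_mod_cast k.succ_ne_zero
      have h1 := ((Complex.ofRealCLM.hasDerivAt (x := w)).pow (k + 1)).mul_const
        (PowerSeries.coeff k D / ((k : ℂ) + 1))
      refine h1.congr_deriv ?_
      simp only [Complex.ofRealCLM_apply, Nat.add_sub_cancel, Complex.ofReal_one]
      push_cast
      field_simp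
    have hZ0 : ∀ w ∈ Set.Icc (0 : ℝ) 1, Z w ≠ 0 := fun w hw => (key w hw).1
    have hHd : ∀ w ∈ Set.Icc (0 : ℝ) 1, HasDerivAt (fun w => Z w * Complex.exp (-p w))
        (ε w * (Z w * Complex.exp (-p w))) w := by
      intro w hw
      refine ((hZd w).mul ((hpd w).neg.cexp)).congr_deriv ?_
      have := hZ0 w hw
      simp only [hε, Pi.neg_apply]
      field_simp
      ring
    have hZ'c : Continuous Z' := by
      obtain ⟨hm, C, hC⟩ := id hfb
      rw [hZ', continuous_iff_continuousAt]
      intro w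
      refine continuousAt_of_dominated (bound := fun _ => C * Real.exp ((|w| + 1) * C))
        (Filter.Eventually.of_forall fun v =>
          (hfb.mul ((BddMeas.const (v : ℂ)).mul hfb).cexp).1.aestronglyMeasurable) ?_
        (integrable_const _) (Filter.Eventually.of_forall fun y => by fun_prop)
      filter_upwards [Metric.ball_mem_nhds w one_pos] with v hv
      refine Filter.Eventually.of_forall fun y => ?_
      exact norm_mul_exp_le (hC y) (by simpa [Real.dist_eq] using hv)
    have hZc : Continuous Z := continuous_iff_continuousAt.2 fun w => (hZd w).continuousAt
    have hεc : ContinuousOn ε (Set.Icc 0 1) := by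
      refine (hZ'c.continuousOn.div hZc.continuousOn hZ0).sub ?_
      exact Continuous.continuousOn (by fun_prop)
    have hεb : ∀ w ∈ Set.Icc (0 : ℝ) 1, ‖ε w‖ ≤ b / ρ ^ m := by
      intro w hw
      obtain ⟨-, c, hc⟩ := key w hw
      rw [le_div_iff₀ (by positivity)]
      refine le_trans (le_of_eq ?_) ((norm_remainder_mul_pow_le h0.le _).trans hc)
      congr 2
      obtain ⟨m, rfl⟩ := Nat.exists_eq_succ_of_ne_zero hm.ne'
      simp only [hε, hZ, hZ', Prod.snd_sub, Prod.fst_sub, map_sub, PowerSeries.coeff_rescale,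
        const, PowerSeries.coeff_C, Finset.sum_sub_distrib]
      simp
    obtain ⟨l, hl, hl'⟩ := exists_eq_mul_exp_of_hasDerivAt hHd hεc hεb
    refine ⟨l, by rwa [le_div_iff₀ (by positivity)] at hl, ?_⟩
    have hZz : Z 0 = 1 := by simp [hZ]
    have hpz : p 0 = 0 := by simp [hp]
    have hp1 : p 1 = ∑ r ∈ Finset.Icc 1 m, cumulantOf ν f r / (r.factorial : ℂ) := by
      rw [hp, ← Finset.Ico_add_one_right_eq_Icc, Finset.sum_Ico_eq_sum_range]
      refine Finset.sum_congr (by simp) fun k _ => ?_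
      have hk0 : (k : ℂ) + 1 ≠ 0 := by exact_mod_cast k.succ_ne_zero
      have hk1 : (k.factorial : ℂ) ≠ 0 := by exact_mod_cast k.factorial_ne_zero
      rw [add_comm 1 k, cumulantOf_succ, Nat.factorial_succ, ← hD]
      push_cast
      simp only [one_pow]
      field_simp
    have hZ1 : Z 1 = ∫ y, Complex.exp (f y) ∂ν := by simp [hZ]
    rw [hZz, hpz, neg_zero, Complex.exp_zero, one_mul, one_mul, hp1, hZ1] at hl'
    rw [← hl', mul_assoc, ← Complex.exp_add]
    simp
  · obtain ⟨-, c, hc⟩ := key 1 (Set.right_mem_Icc.2 zero_le_one)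
    have h1 := (norm_coeff_mul_pow_le (N := m) h0.le _ hk).trans hc
    rw [Prod.fst_sub, map_sub, const, PowerSeries.coeff_rescale, PowerSeries.coeff_C,
      if_neg hk0.ne', sub_zero, Complex.ofReal_one, one_pow, one_mul] at h1
    rw [cumulantOf_succ, norm_mul, Complex.norm_natCast, mul_assoc]
    gcongr

end Jet

theorem exists_one_add_pow_eq_exp {n : ℕ} {l : ℂ} {c : ℝ} (hc : 0 ≤ c) (hl : ‖l‖ ≤ n * c) :
    ∃ δ : ℂ, ‖δ‖ ≤ Real.exp c - 1 ∧ (1 + δ) ^ n = Complex.exp l := by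
  rcases Nat.eq_zero_or_pos n with rfl | hn
  · have : l = 0 := by simpa using hl
    exact ⟨0, by simpa using hc, by simp [this]⟩
  have hn0 : (n : ℂ) ≠ 0 := by exact_mod_cast hn.ne'
  refine ⟨Complex.exp (l / n) - 1, ?_, ?_⟩
  · have h1 := Complex.norm_exp_sub_sum_le_exp_norm_sub_sum (l / n) 1
    simp only [Finset.range_one, Finset.sum_singleton, pow_zero, Nat.factorial_zero,
      Nat.cast_one, div_one] at h1
    refine h1.trans ?_
    gcongr
    rw [norm_div, Complex.norm_natCast, div_le_iff₀ (by exact_mod_cast hn), mul_comm]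
    exact hl
  · rw [add_sub_cancel, ← Complex.exp_nat_mul, mul_div_cancel₀ _ hn0]

theorem six_mul_le_eight_pow {r : ℕ} (hr : 2 ≤ r) : 6 * (r : ℝ) ≤ 8 ^ r := by
  induction r, hr using Nat.le_induction with
  | base => norm_num
  | succ r hr ih =>
    have : (2 : ℝ) ≤ r := by exact_mod_cast hr
    push_cast
    rw [pow_succ]
    linarith

/-- A vanishing weight means a vanishing interaction, so that `γ` becomes irrelevant. -/
theorem locWeight_eq_zero {n : ℕ} {Ω : Fin n → Type*} {π : Finset (Fin n) → (∀ i, Ω i) → ℂ}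
    {γ γ' : ℝ} {j : Fin n} {y : ∀ i, Ω i} {U : Finset (Fin n)}
    (h : locWeight γ π j U y ≤ 0) : locWeight γ' π j U y = 0 := by
  have h1 := supNorm_nonneg π U
  have h2 := Jet.condSup_nonneg π j U y
  have e1 := Real.exp_pos (γ * (U.card : ℝ))
  have e2 := Real.exp_pos (γ * ((U.card - 1 : ℕ) : ℝ))
  rw [locWeight] at h
  have k1 : supNorm π U * Real.exp (γ * (U.card : ℝ)) = 0 :=
    le_antisymm (by linarith [mul_nonneg h2 e2.le]) (mul_nonneg h1 e1.le)
  have k2 : Jet.condSup π j U y * Real.exp (γ * ((U.card - 1 : ℕ) : ℝ)) = 0 :=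
    le_antisymm (by linarith [mul_nonneg h1 e1.le]) (mul_nonneg h2 e2.le)
  rw [locWeight, (mul_eq_zero.1 k1).resolve_right e1.ne', (mul_eq_zero.1 k2).resolve_right e2.ne']
  simp

end

theorem mainTheorem2 {n : ℕ} {Ω : Fin n → Type*} [∀ i, MeasurableSpace (Ω i)]
    {S : Type*} [MeasurableSpace S] (P : Measure S) [IsProbabilityMeasure P]
    (X : ∀ i, S → Ω i) (hX : ∀ i, Measurable (X i)) (hindep : iIndepFun X P)
    (m : ℕ) (hm : 0 < m) (α γ : ℝ) (hα0 : 0 ≤ α) (hα1 : α ≤ 1 / 100) (hγ : 3 / 2 * α ≤ γ)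
    (π : Finset (Fin n) → (∀ i, Ω i) → ℂ) (hπ : IsBddDecomposition π)
    (hΓ : ∀ t ∈ Finset.Icc 1 m, ∀ j : Fin n,
      ∑ V ∈ (Finset.univ : Finset (Finset (Fin n))) with V.card = t ∧ j ∈ V,
        decompGamma V γ π ≤ α) :
    (∃ δ : ℂ, ‖δ‖ ≤ Real.exp ((100 * α) ^ (m + 1)) - 1 ∧
      ∫ s, Complex.exp (decompFun π fun i => X i s) ∂P =
        (1 + δ) ^ n * Complex.exp (∑ r ∈ Finset.Icc 1 m,
          cumulantOf P (fun s => decompFun π fun i => X i s) r / (r.factorial : ℂ))) ∧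
    ∀ r ∈ Finset.Icc 2 m,
      ‖cumulantOf P (fun s => decompFun π fun i => X i s) r‖ ≤
        n * (((r - 1).factorial : ℝ) / (50 * r)) * (80 * α) ^ r := by
  have hprob : ∀ i, IsProbabilityMeasure (P.map (X i)) := fun i =>
    Measure.isProbabilityMeasure_map (hX i).aemeasurable
  set ν := Measure.pi fun i => P.map (X i) with hν
  have hXm : Measurable fun s i => X i s := measurable_pi_lambda _ hX
  have hmap : P.map (fun s i => X i s) = ν :=
    (iIndepFun_iff_map_fun_eq_pi_map fun i => (hX i).aemeasurable).1 hindep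
  have hfb : BddMeas (decompFun π) := BddMeas.sum _ fun V _ => hπ.bddMeas V
  have htrans : ∀ {g : (∀ i, Ω i) → ℂ}, BddMeas g →
      ∫ s, g (fun i => X i s) ∂P = ∫ y, g y ∂ν := by
    intro g hg
    rw [← hmap, integral_map hXm.aemeasurable hg.1.aestronglyMeasurable]
  have hcum : ∀ r, cumulantOf P (fun s => decompFun π fun i => X i s) r =
      cumulantOf ν (decompFun π) r := by
    intro r
    have : momentSeries P (fun s => decompFun π fun i => X i s) =
        momentSeries ν (decompFun π) := by
      ext k
      simp only [momentSeries, PowerSeries.coeff_mk]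
      rw [htrans (hfb.pow k)]
    rw [cumulantOf, cumulantOf, this]
  rw [htrans hfb.cexp]
  simp only [hcum]
  have H := fun j (y : ∀ i, Ω i) k (hk : k < m) => sum_choose_mul_locWeight_le hπ hΓ j y hk
  rcases hα0.eq_or_lt with rfl | hαpos
  · -- the scale `1 / (10 α)` is not available; all interactions vanish, and `γ = ρ = 1` will do
    have H' : ∀ j, ∀ y : ∀ i, Ω i, ∀ k < m, ∑ U : Finset (Fin n) with j ∈ U,
        ((U.card - 1).choose k : ℝ) * locWeight 1 π j U y ≤ 0 := by
      intro j y k _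
      refine Finset.sum_nonpos fun U hU => ?_
      have h1 := H j y 0 hm
      simp only [Nat.choose_zero_right, Nat.cast_one, one_mul] at h1
      have h2 := (Finset.single_le_sum (f := fun U => locWeight γ π j U y)
        (fun U _ => locWeight_nonneg γ π j U y) hU).trans h1
      rw [locWeight_eq_zero h2, mul_zero]
    obtain ⟨⟨l, hl, hE⟩, hκ⟩ := Jet.cumulant_expansion (μ := fun i => P.map (X i)) hπ hm
      le_rfl le_rfl (by norm_num) (by norm_num) H'
    have hl0 : l = 0 := by simpa using hl
    refine ⟨⟨0, by simp, ?_⟩, fun r hr => ?_⟩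
    · rw [hν, hE, hl0]; simp
    · obtain ⟨k, rfl⟩ := Nat.exists_eq_add_of_le' (show 1 ≤ r from
        one_le_two.trans (Finset.mem_Icc.1 hr).1)
      have hr' := Finset.mem_Icc.1 hr
      have := hκ k (by omega) (by omega)
      simpa using this
  · -- at the scale `ρ = 1 / (10 α)` the condition `3 / 20 / ρ ≤ γ` is `3 α / 2 ≤ γ`
    have hρα : 1 / (10 * α) * α = 1 / 10 := by field_simp
    have hρ : 1 ≤ 1 / (10 * α) := by
      rw [le_div_iff₀ (by positivity)]; linarith
    have hργ : 3 / 20 / (1 / (10 * α)) ≤ γ := by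
      refine le_trans (le_of_eq ?_) hγ
      field_simp
      norm_num
    obtain ⟨⟨l, hl, hE⟩, hκ⟩ := Jet.cumulant_expansion (μ := fun i => P.map (X i)) hπ hm
      hρ hα0 hρα.le hργ H
    have hpow : ∀ k (c b : ℝ), c * (1 / (10 * α)) ^ k ≤ b → c ≤ b * (10 * α) ^ k := by
      intro k c b h
      rw [one_div, inv_pow, ← div_eq_mul_inv, div_le_iff₀ (by positivity)] at h
      exact h
    refine ⟨?_, fun r hr => ?_⟩
    · have hl' := hpow _ _ _ hl
      obtain ⟨δ, hδ, hδ'⟩ := exists_one_add_pow_eq_exp (n := n) (l := l)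
        (c := (100 * α) ^ (m + 1)) (by positivity) (by
          refine hl'.trans ?_
          rw [mul_assoc]
          gcongr
          calc 20 / 17 * α * (10 * α) ^ m ≤ 100 * α * (100 * α) ^ m := by gcongr <;> norm_num
            _ = _ := by rw [pow_succ]; ring)
      exact ⟨δ, hδ, by rw [hδ', hν, hE]⟩
    · have hr' := Finset.mem_Icc.1 hr
      obtain ⟨k, rfl⟩ := Nat.exists_eq_add_of_le' (show 1 ≤ r from one_le_two.trans hr'.1)
      have h1 := hpow _ _ _ (hκ k (by omega) (by omega))
      refine h1.trans ?_
      rw [Nat.add_sub_cancel]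
      have h2 := six_mul_le_eight_pow hr'.1
      calc (k.factorial : ℝ) * (n * (20 / 17 * α)) * (10 * α) ^ k
          = n * k.factorial * (10 * α) ^ (k + 1) * (2 / 17) := by rw [pow_succ]; ring
        _ ≤ n * k.factorial * (10 * α) ^ (k + 1) * (8 ^ (k + 1) / (50 * ((k + 1 : ℕ) : ℝ))) := by
            refine mul_le_mul_of_nonneg_left ?_ (by positivity)
            rw [div_le_div_iff₀ (by norm_num) (by positivity)]
            linarith
        _ = _ := by
            rw [show (80 * α) = 8 * (10 * α) by ring, mul_pow 8]
            ring
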